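/- Let $d$ be a nonnegative integer. For $\mu$ an infinitely divisible distribution on $\mathbb R^d$ write its characteristic function in the Lévy–Khintchine form $$\widehat\mu(z)=\exp\Bigl[-\tfrac12\langle z,A_\mu z\rangle+\int_{\mathbb R^d}\bigl(e^{i\langle z,x\rangle}-1-i\langle z,x\rangle 1_{\{|x|\le 1\}}(x)\bigr)\,\nu_\mu(dx)+i\langle\gamma_\mu,z\rangle\Bigr],\qquad z\in\mathbb R^d,$$ with $A_\mu$ symmetric nonnegative-definite, $\nu_\mu(\{0\})=0$, $\int(|x|^2\wedge1)\,\nu_\mu(dx)<\infty$ and $\gamma_\mu\in\mathbb R^d$. Let $ID_0$ be the class of infinitely divisible distributions $\mu$ on $\mathbb R^d$ with $A_\mu=0$. We say that $\mu$ has drift if $\int_{|x|\le1}|x|\,\nu_\mu(dx)<\infty$; its drift is then the vector $\gamma^0_\mu$ with $$\widehat\mu(z)=\exp\Bigl[-\tfrac12\langle z,A_\mu z\rangle+\int(e^{i\langle z,x\rangle}-1)\,\nu_\mu(dx)+i\langle\gamma^0_\mu,z\rangle\Bigr],\qquad z\in\mathbb R^d.$$ We say that $\mu$ has mean if $\int|x|\,\mu(dx)<\infty$;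 its mean is then $m_\mu=\int x\,\mu(dx)$. For $s\ge0$, $\mu^s$ denotes the distribution with characteristic function $\widehat\mu(z)^s=e^{s\psi(z)}$, where $\psi$ is the continuous function with $\psi(0)=0$ and $e^{\psi}=\widehat\mu$. For $\mu\in ID_0$, a distribution $\mu'\in ID_0$ is called an inversion of $\mu$ if, with $\iota(x)=|x|^{-2}x$ for $x\neq0$, $$\nu_{\mu'}(B)=\int_{\mathbb R^d\setminus\{0\}}1_B(\iota(x))\,|x|^2\,\nu_\mu(dx)\quad\text{for all Borel sets }B\subseteq\mathbb R^d,\qquad \gamma_{\mu'}=-\gamma_\mu+\int_{|x|=1}x\,\nu_\mu(dx).$$ Then: (i) Every $\mu\in ID_0$ has exactly one inversion $\mu'\in ID_0$. (ii) $\mu''=\mu$ for $\mu\in ID_0$. (iii) For $\mu\in ID_0$ and every $\alpha\in\mathbb R$, $\int_{|x|\le1}|x|^{2-\alpha}\,\nu_{\mu'}(dx)=\int_{|x|\ge1}|x|^{\alpha}\,\nu_\mu(dx)$, as elements of $[0,\infty]$. (iv) For $\mu\in ID_0$, $\mu'$ has drift if and only if $\mu$ has mean. (v) If $\mu\in ID_0$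 has mean, then $\mu'$ has drift and $\gamma^0_{\mu'}=-m_\mu$. (vi) If $\mu$ and $\mu_n$, $n=1,2,\dots$, are in $ID_0$ and $\mu_n\to\mu$ weakly, then $\mu_n'\to\mu'$ weakly. (vii) If $\mu_1,\mu_2\in ID_0$, then $\mu_1*\mu_2\in ID_0$ and $(\mu_1*\mu_2)'=\mu_1'*\mu_2'$. (viii) If $\mu\in ID_0$ and $s\ge0$, then $\mu^s$ exists, is unique and lies in $ID_0$, and $(\mu^s)'=(\mu')^s$. (ix) For $c\in\mathbb R^d$, the point mass $\delta_c$ lies in $ID_0$ and $(\delta_c)'=\delta_{-c}$. -/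

import Mathlib

open MeasureTheory Filter Topology
open scoped ENNReal

noncomputable section

namespace LevyInversion

/-- The `d`-dimensional Euclidean space. -/
abbrev Rd (d : ℕ) : Type := EuclideanSpace ℝ (Fin d)

variable {d : ℕ}

/-- Convolution of two distributions. -/
def conv (μ₁ μ₂ : ProbabilityMeasure (Rd d)) : ProbabilityMeasure (Rd d) :=
  ⟨(μ₁ : Measure (Rd d)).conv (μ₂ : Measure (Rd d)), inferInstance⟩

/-- The `n`-fold convolution of a distribution with itself (`δ_0` for `n = 0`). -/
def convIter (ρ : ProbabilityMeasure (Rd d)) : ℕ → ProbabilityMeasure (Rd d)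
  | 0 => diracProba 0
  | n + 1 => conv (convIter ρ n) ρ

/-- The class `ID` of infinitely divisible distributions: for every `n ≥ 1` there is an
`n`-th convolution root. -/
def ID (d : ℕ) : Set (ProbabilityMeasure (Rd d)) :=
  {μ | ∀ n : ℕ, 1 ≤ n → ∃ ρ : ProbabilityMeasure (Rd d), convIter ρ n = μ}

/-- `ν` is a Lévy measure: `ν({0}) = 0` and `∫ (|x|² ∧ 1) ν(dx) < ∞`. -/
def IsLevyMeasure (ν : Measure (Rd d)) : Prop :=
  ν {0} = 0 ∧ ∫⁻ x, ENNReal.ofReal (min (‖x‖ ^ 2) 1) ∂ν < ∞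

/-- The quadratic form `⟨z, A z⟩`. -/
def quadForm (A : Matrix (Fin d) (Fin d) ℝ) (z : Rd d) : ℝ :=
  inner ℝ z (Matrix.toEuclideanLin A z)

/-- The integrand `e^{i⟨z,x⟩} - 1 - i⟨z,x⟩ 1_{|x| ≤ 1}(x)` of the Lévy–Khintchine formula. -/
def levyIntegrand (z x : Rd d) : ℂ :=
  Complex.exp (Complex.I * (inner ℝ z x : ℝ)) - 1 -
    Complex.I * (inner ℝ z x : ℝ) * (Metric.closedBall (0 : Rd d) 1).indicator (fun _ => 1) x

/-- `(A, ν, γ)` is a Lévy–Khintchine triplet of `μ`: `A` is symmetric nonnegative-definite, `ν` is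
a Lévy measure, and the characteristic function of `μ` is given by the Lévy–Khintchine formula. -/
structure HasTriplet (μ : ProbabilityMeasure (Rd d)) (A : Matrix (Fin d) (Fin d) ℝ)
    (ν : Measure (Rd d)) (γ : Rd d) : Prop where
  posSemidef : A.PosSemidef
  isLevyMeasure : IsLevyMeasure ν
  charFun_eq : ∀ z : Rd d, charFun (μ : Measure (Rd d)) z =
    Complex.exp (-(1 / 2 : ℂ) * (quadForm A z : ℝ) + (∫ x, levyIntegrand z x ∂ν)
      + Complex.I * (inner ℝ γ z : ℝ))

/-- The triplet `(A_μ, ν_μ, γ_μ)` of `μ` (arbitrary if `μ` has none; an infinitely divisible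
distribution has exactly one). -/
def triplet (μ : ProbabilityMeasure (Rd d)) :
    Matrix (Fin d) (Fin d) ℝ × Measure (Rd d) × Rd d :=
  Classical.epsilon fun t => HasTriplet μ t.1 t.2.1 t.2.2

/-- The Gaussian covariance matrix `A_μ`. -/
def gaussCov (μ : ProbabilityMeasure (Rd d)) : Matrix (Fin d) (Fin d) ℝ := (triplet μ).1

/-- The Lévy measure `ν_μ`. -/
def levyMeasure (μ : ProbabilityMeasure (Rd d)) : Measure (Rd d) := (triplet μ).2.1

/-- The location parameter `γ_μ`. -/
def location (μ : ProbabilityMeasure (Rd d)) : Rd d := (triplet μ).2.2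

/-- The class `ID_0` of infinitely divisible distributions without Gaussian part, that is, whose
Lévy–Khintchine representation has `A = 0`. -/
def ID0 (d : ℕ) : Set (ProbabilityMeasure (Rd d)) :=
  {μ | μ ∈ ID d ∧ ∃ (ν : Measure (Rd d)) (γ : Rd d), HasTriplet μ 0 ν γ}

/-- `μ` has drift: `∫_{|x| ≤ 1} |x| ν_μ(dx) < ∞`. -/
def HasDrift (μ : ProbabilityMeasure (Rd d)) : Prop :=
  ∫⁻ x in Metric.closedBall (0 : Rd d) 1, ENNReal.ofReal ‖x‖ ∂(levyMeasure μ) < ∞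

/-- `μ` has drift and its drift `γ⁰_μ` equals `c`, the drift being the vector for which
`μ̂(z) = exp(-½⟨z, A_μ z⟩ + ∫ (e^{i⟨z,x⟩} - 1) ν_μ(dx) + i⟨γ⁰_μ, z⟩)`. -/
def IsDrift (μ : ProbabilityMeasure (Rd d)) (c : Rd d) : Prop :=
  HasDrift μ ∧ ∀ z : Rd d, charFun (μ : Measure (Rd d)) z =
    Complex.exp (-(1 / 2 : ℂ) * (quadForm (gaussCov μ) z : ℝ)
      + (∫ x, (Complex.exp (Complex.I * (inner ℝ z x : ℝ)) - 1) ∂(levyMeasure μ))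
      + Complex.I * (inner ℝ c z : ℝ))

/-- `μ` has mean: `∫ |x| μ(dx) < ∞`. -/
def HasMean (μ : ProbabilityMeasure (Rd d)) : Prop :=
  Integrable (fun x : Rd d => x) (μ : Measure (Rd d))

/-- The mean `m_μ` (meaningful if `HasMean μ`). -/
def mean (μ : ProbabilityMeasure (Rd d)) : Rd d := ∫ x, x ∂(μ : Measure (Rd d))

/-- The geometric inversion `ι(x) = |x|⁻² x` (used for `x ≠ 0` only). -/
def geomInv (x : Rd d) : Rd d := (‖x‖ ^ 2)⁻¹ • x

/-- `μ' ∈ ID_0` is an inversion of `μ ∈ ID_0`. -/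
structure IsInversion (μ μ' : ProbabilityMeasure (Rd d)) : Prop where
  mem : μ ∈ ID0 d
  mem' : μ' ∈ ID0 d
  levyMeasure_eq : ∀ B : Set (Rd d), MeasurableSet B →
    levyMeasure μ' B =
      ∫⁻ x in {(0 : Rd d)}ᶜ, B.indicator (fun _ => 1) (geomInv x) * ENNReal.ofReal (‖x‖ ^ 2)
        ∂(levyMeasure μ)
  location_eq : location μ' =
    -location μ + ∫ x in Metric.sphere (0 : Rd d) 1, x ∂(levyMeasure μ)

/-- The inversion `μ'` of `μ` (arbitrary if there is none). -/
def inversion (μ : ProbabilityMeasure (Rd d)) : ProbabilityMeasure (Rd d) :=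
  haveI : Nonempty (ProbabilityMeasure (Rd d)) := ⟨diracProba 0⟩
  Classical.epsilon fun μ' => IsInversion μ μ'

/-- `ρ` is the convolution power `μ^s`: its characteristic function is `μ̂(z)^s = exp(s ψ(z))`,
where `ψ` is the distinguished logarithm of `μ̂`, i.e. the continuous function with `ψ(0) = 0` and
`exp ψ = μ̂`. -/
def IsConvPower (μ : ProbabilityMeasure (Rd d)) (s : ℝ) (ρ : ProbabilityMeasure (Rd d)) : Prop :=
  ∃ ψ : Rd d → ℂ, Continuous ψ ∧ ψ 0 = 0 ∧
    (∀ z, charFun (μ : Measure (Rd d)) z = Complex.exp (ψ z)) ∧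
    ∀ z, charFun (ρ : Measure (Rd d)) z = Complex.exp ((s : ℂ) * ψ z)

/-- The convolution power `μ^s` (arbitrary if it does not exist). -/
def convPower (μ : ProbabilityMeasure (Rd d)) (s : ℝ) : ProbabilityMeasure (Rd d) :=
  haveI : Nonempty (ProbabilityMeasure (Rd d)) := ⟨diracProba 0⟩
  Classical.epsilon fun ρ => IsConvPower μ s ρ

end LevyInversion

end

/-! On `ID0` a law is the same thing as a pair (ν, γ): every Lévy measure ν and vector γ occur, and
the law determines them. Inversion therefore becomes the explicit map sending ν to the image under ι
of |x|²ν, and γ to -γ + S with S = ∫_{|x|=1} x ν(dx). It preserves Lévy measures because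
|x|²(|ι(x)|² ∧ 1) = |x|² ∧ 1. It is an involution because |x|²|ι(x)|² = 1 for x ≠ 0 and S is
unchanged. It is additive and positively homogeneous, while exponents are linear in (ν, γ). Clauses
(i)-(iii) and (vii)-(ix) follow.

Uniqueness of (ν, γ) and continuity (vi) rest on one identity, `sum_integral_secondDiff`. Averaging
symmetric second differences of the exponent over steps t in [0,1] and summing over coordinates
kills γ, turns the Gaussian part into a constant, and turns the jump part into the characteristic
function of the finite measure wν, where w = ∑ (1 - sinc xⱼ) is comparable with |x|² ∧ 1. For (vi),
weak convergence makes characteristic functions, hence their continuous logarithms, converge locally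
uniformly. So wνₙ → wν weakly, and the limit has no atom at 0. Truncating by 1/(1+|x|²) instead of
the indicator of the unit ball makes the integrand continuous, and in this normalization inversion
just changes the sign of the location (`smoothLocation_inv`).

For (iv), the case α = 1 of (iii) reduces the claim to the equivalence between a finite mean of μ
and ∫_{|x|≥1} |x| ν(dx) < ∞ (`HasTriplet.hasMean_iff`). Both are tested by integrating against t⁻²
dt on (0,1]: 1 - Re μ̂(teⱼ) on one side and ∫ (1 - cos(t xⱼ)) ν(dx) on the other, which are
comparable up to a constant factor or an O(t²) error. For (v), differentiating μ̂ at 0 gives m = γ +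
∫_{|x|>1} x ν(dx), and the change of variables ι turns the formula for the drift of μ' into -m. -/

noncomputable section

namespace LevyInversion

variable {d : ℕ}

/-! ### Lévy measures, exponents and distinguished logarithms -/

/-- The exponent in the Lévy–Khintchine formula with triplet `(A, ν, γ)`. -/
def levyExponent (A : Matrix (Fin d) (Fin d) ℝ) (ν : Measure (Rd d)) (γ z : Rd d) : ℂ :=
  -(1 / 2 : ℂ) * (quadForm A z : ℝ) + (∫ x, levyIntegrand z x ∂ν) + Complex.I * (inner ℝ γ z : ℝ)

/-- The function `|x|² ∧ 1`. -/
def sqMin (x : Rd d) : ℝ := min (‖x‖ ^ 2) 1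

lemma sqMin_nonneg (x : Rd d) : 0 ≤ sqMin x := le_min (by positivity) zero_le_one

lemma sqMin_pos {x : Rd d} (hx : x ≠ 0) : 0 < sqMin x :=
  lt_min (by positivity) zero_lt_one

lemma continuous_sqMin : Continuous (sqMin : Rd d → ℝ) := by unfold sqMin; fun_prop

lemma measurable_sqMin : Measurable (sqMin : Rd d → ℝ) := continuous_sqMin.measurable

namespace IsLevyMeasure

variable {ν : Measure (Rd d)}

lemma ae_ne_zero (hν : IsLevyMeasure ν) : ∀ᵐ x ∂ν, x ≠ 0 := by
  rw [ae_iff]; simpa using hν.1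

lemma integrable_sqMin (hν : IsLevyMeasure ν) : Integrable sqMin ν := by
  refine ⟨measurable_sqMin.aestronglyMeasurable, ?_⟩
  rw [hasFiniteIntegral_iff_ofReal (ae_of_all _ sqMin_nonneg)]
  exact hν.2

/-- The measure (|x|² ∧ 1)ν is finite, and its density is positive ν-a.e., so ν is recovered from it
by a finite density. Needed for Fubini and Tonelli. -/
lemma sigmaFinite (hν : IsLevyMeasure ν) : SigmaFinite ν := by
  have hm : Measurable fun x : Rd d => ENNReal.ofReal (sqMin x) :=
    measurable_sqMin.ennreal_ofReal
  have : IsFiniteMeasure (ν.withDensity fun x => ENNReal.ofReal (sqMin x)) :=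
    isFiniteMeasure_withDensity hν.2.ne
  have h := withDensity_inv_same₀ (μ := ν) hm.aemeasurable
    (by filter_upwards [hν.ae_ne_zero] with x hx; simpa using sqMin_pos hx)
    (ae_of_all _ fun _ => ENNReal.ofReal_ne_top)
  rw [← h]
  refine SigmaFinite.withDensity_of_ne_top ?_
  refine (withDensity_absolutelyContinuous _ _).ae_le ?_
  filter_upwards [hν.ae_ne_zero] with x hx
  simpa using sqMin_pos hx

end IsLevyMeasure

lemma norm_exp_I_mul_sub_one_le (u : ℝ) : ‖Complex.exp (Complex.I * u) - 1‖ ≤ |u| := by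
  simpa using Real.norm_exp_I_mul_ofReal_sub_one_le (x := u)

lemma norm_exp_I_mul_sub_one_le_two (u : ℝ) : ‖Complex.exp (Complex.I * u) - 1‖ ≤ 2 := by
  refine (norm_sub_le _ _).trans ?_
  rw [Complex.norm_exp_I_mul_ofReal]; norm_num

lemma norm_exp_I_mul_sub_one_sub_le (u : ℝ) :
    ‖Complex.exp (Complex.I * u) - 1 - Complex.I * u‖ ≤ 3 * u ^ 2 := by
  have hu : ‖Complex.I * (u : ℂ)‖ = |u| := by simp
  rcases le_or_gt |u| 1 with h | h
  · have := Complex.norm_exp_sub_one_sub_id_le (x := Complex.I * u) (by rwa [hu])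
    rw [hu, sq_abs] at this
    nlinarith [sq_nonneg u]
  · refine (norm_sub_le _ _).trans ?_
    rw [hu]
    have := norm_exp_I_mul_sub_one_le_two u
    nlinarith [sq_abs u]

lemma levyIntegrand_of_le {z x : Rd d} (hx : ‖x‖ ≤ 1) :
    levyIntegrand z x = Complex.exp (Complex.I * (inner ℝ z x : ℝ)) - 1 -
      Complex.I * (inner ℝ z x : ℝ) := by
  simp [levyIntegrand, hx]

lemma levyIntegrand_of_lt {z x : Rd d} (hx : 1 < ‖x‖) :
    levyIntegrand z x = Complex.exp (Complex.I * (inner ℝ z x : ℝ)) - 1 := by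
  simp [levyIntegrand, hx]

lemma abs_inner_le (z x : Rd d) : |inner ℝ z x| ≤ ‖z‖ * ‖x‖ := abs_real_inner_le_norm z x

lemma norm_levyIntegrand_le (z x : Rd d) :
    ‖levyIntegrand z x‖ ≤ (2 + 3 * ‖z‖ ^ 2) * sqMin x := by
  rcases le_or_gt ‖x‖ 1 with h | h
  · rw [levyIntegrand_of_le h, sqMin, min_eq_left (by nlinarith [norm_nonneg x])]
    refine (norm_exp_I_mul_sub_one_sub_le _).trans ?_
    have h1 := abs_inner_le z x
    have h2 : (inner ℝ z x : ℝ) ^ 2 ≤ (‖z‖ * ‖x‖) ^ 2 := by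
      rw [← sq_abs]; gcongr
    nlinarith [sq_nonneg ‖x‖, sq_nonneg ‖z‖]
  · rw [levyIntegrand_of_lt h, sqMin, min_eq_right (by nlinarith [norm_nonneg x])]
    refine (norm_exp_I_mul_sub_one_le_two _).trans ?_
    nlinarith [sq_nonneg ‖z‖]

lemma measurable_levyIntegrand (z : Rd d) : Measurable (levyIntegrand z) := by
  have h : Measurable ((Metric.closedBall (0 : Rd d) 1).indicator fun _ => (1 : ℂ)) :=
    measurable_const.indicator measurableSet_closedBall
  unfold levyIntegrand
  fun_prop

lemma continuous_levyIntegrand_left (x : Rd d) : Continuous fun z => levyIntegrand z x := by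
  unfold levyIntegrand; fun_prop

lemma levyIntegrand_zero_left (x : Rd d) : levyIntegrand 0 x = 0 := by simp [levyIntegrand]

lemma integrable_levyIntegrand {ν : Measure (Rd d)} (hν : IsLevyMeasure ν) (z : Rd d) :
    Integrable (levyIntegrand z) ν :=
  (hν.integrable_sqMin.const_mul _).mono' (measurable_levyIntegrand z).aestronglyMeasurable
    (ae_of_all _ fun x => norm_levyIntegrand_le z x)

lemma continuous_quadForm (A : Matrix (Fin d) (Fin d) ℝ) : Continuous (quadForm A) := by
  unfold quadForm
  exact continuous_id.inner (LinearMap.continuous_of_finiteDimensional _)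

lemma continuous_integral_levyIntegrand {ν : Measure (Rd d)} (hν : IsLevyMeasure ν) :
    Continuous fun z => ∫ x, levyIntegrand z x ∂ν := by
  refine continuous_iff_continuousAt.2 fun z₀ => ?_
  refine continuousAt_of_dominated (bound := fun x => (2 + 3 * (‖z₀‖ + 1) ^ 2) * sqMin x)
    (.of_forall fun z => (measurable_levyIntegrand z).aestronglyMeasurable) ?_
    (hν.integrable_sqMin.const_mul _)
    (ae_of_all _ fun x => (continuous_levyIntegrand_left x).continuousAt)
  filter_upwards [Metric.ball_mem_nhds z₀ one_pos] with z hz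
  refine ae_of_all _ fun x => (norm_levyIntegrand_le z x).trans ?_
  have : ‖z‖ ≤ ‖z₀‖ + 1 := by
    have := norm_sub_norm_le z z₀
    rw [mem_ball_iff_norm] at hz
    linarith
  have := sqMin_nonneg x
  gcongr

lemma continuous_levyExponent {ν : Measure (Rd d)} (hν : IsLevyMeasure ν)
    (A : Matrix (Fin d) (Fin d) ℝ) (γ : Rd d) : Continuous (levyExponent A ν γ) := by
  have := continuous_quadForm A
  have := continuous_integral_levyIntegrand hν
  unfold levyExponent
  fun_prop

lemma levyExponent_zero (A : Matrix (Fin d) (Fin d) ℝ) (ν : Measure (Rd d)) (γ : Rd d) :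
    levyExponent A ν γ 0 = 0 := by
  simp [levyExponent, quadForm, levyIntegrand_zero_left]

/-- Two continuous logarithms of the same function that agree at one point agree. -/
lemma eqOn_of_exp_eq {X : Type*} [TopologicalSpace X] {s : Set X} (hs : IsPreconnected s)
    {f g : X → ℂ} (hf : ContinuousOn f s) (hg : ContinuousOn g s)
    (h : ∀ x ∈ s, Complex.exp (f x) = Complex.exp (g x)) {a : X} (ha : a ∈ s) (hfg : f a = g a) :
    Set.EqOn f g s :=
  Complex.isCoveringMap_exp.eqOn_of_comp_eqOn hs hf hg (fun x hx => Subtype.ext (h x hx)) ha hfg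

/-- Uniqueness of the distinguished logarithm: this is how equalities of characteristic functions
pass to exponents. -/
lemma eq_of_exp_eq {f g : Rd d → ℂ} (hf : Continuous f) (hg : Continuous g)
    (hf0 : f 0 = 0) (hg0 : g 0 = 0) (h : ∀ z, Complex.exp (f z) = Complex.exp (g z)) : f = g :=
  Set.eqOn_univ f g |>.1 <| eqOn_of_exp_eq isPreconnected_univ hf.continuousOn hg.continuousOn
    (fun z _ => h z) (Set.mem_univ 0) (hf0.trans hg0.symm)

namespace HasTriplet

variable {μ μ' : ProbabilityMeasure (Rd d)} {A : Matrix (Fin d) (Fin d) ℝ} {ν : Measure (Rd d)}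
  {γ : Rd d}

lemma charFun_eq_exp (h : HasTriplet μ A ν γ) (z : Rd d) :
    charFun (μ : Measure (Rd d)) z = Complex.exp (levyExponent A ν γ z) := h.charFun_eq z

lemma continuous_exponent (h : HasTriplet μ A ν γ) : Continuous (levyExponent A ν γ) :=
  continuous_levyExponent h.isLevyMeasure A γ

end HasTriplet

lemma eq_of_charFun_eq {μ μ' : ProbabilityMeasure (Rd d)}
    (h : ∀ z, charFun (μ : Measure (Rd d)) z = charFun (μ' : Measure (Rd d)) z) : μ = μ' :=
  Subtype.ext (Measure.ext_of_charFun (μ := (μ : Measure (Rd d))) (ν := (μ' : Measure (Rd d)))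
    (funext h))

lemma HasTriplet.unique_law {μ μ' : ProbabilityMeasure (Rd d)} {A : Matrix (Fin d) (Fin d) ℝ}
    {ν : Measure (Rd d)} {γ : Rd d} (h : HasTriplet μ A ν γ) (h' : HasTriplet μ' A ν γ) :
    μ = μ' :=
  eq_of_charFun_eq fun z => by rw [h.charFun_eq, h'.charFun_eq]

/-! ### Existence of laws with a given Lévy measure and location -/

/-- The form of Lévy's continuity theorem that produces the limit law: continuity at 0 gives
tightness, Prokhorov's theorem gives a limit along an ultrafilter, and its characteristic function
must be `f`. -/
lemma exists_charFun_eq_of_tendsto {μ : ℕ → ProbabilityMeasure (Rd d)} {f : Rd d → ℂ}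
    (hf : ContinuousAt f 0)
    (h : ∀ z, Tendsto (fun n => charFun (μ n : Measure (Rd d)) z) atTop (𝓝 (f z))) :
    ∃ μ₀ : ProbabilityMeasure (Rd d), ∀ z, charFun (μ₀ : Measure (Rd d)) z = f z := by
  have ht : IsTightMeasureSet (Set.range fun n => (μ n : Measure (Rd d))) :=
    isTightMeasureSet_of_tendsto_charFun hf h
  have hc : IsCompact (closure (Set.range μ)) :=
    isCompact_closure_of_isTightMeasureSet (by
      convert ht using 1
      ext; simp)
  let U : Ultrafilter ℕ := Ultrafilter.of atTop
  have hU : (U : Filter ℕ) ≤ atTop := Ultrafilter.of_le _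
  obtain ⟨μ₀, -, hμ₀ : Tendsto μ U (𝓝 μ₀)⟩ := hc.ultrafilter_le_nhds (U.map μ)
    (.trans (by simp) (monotone_principal subset_closure))
  refine ⟨μ₀, fun z => ?_⟩
  rw [ProbabilityMeasure.tendsto_iff_forall_integral_rclike_tendsto ℂ] at hμ₀
  have h1 := hμ₀ (BoundedContinuousFunction.innerProbChar z)
  simp_rw [← charFun_eq_integral_innerProbChar] at h1
  exact tendsto_nhds_unique h1 ((h z).comp hU)

lemma charFun_conv_coe (μ₁ μ₂ : ProbabilityMeasure (Rd d)) (z : Rd d) :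
    charFun (conv μ₁ μ₂ : Measure (Rd d)) z =
      charFun (μ₁ : Measure (Rd d)) z * charFun (μ₂ : Measure (Rd d)) z :=
  charFun_conv z

lemma charFun_diracProba (c z : Rd d) :
    charFun (diracProba c : Measure (Rd d)) z = Complex.exp (Complex.I * (inner ℝ c z : ℝ)) := by
  have : (diracProba c : Measure (Rd d)) = Measure.dirac c := rfl
  rw [this, charFun_dirac, mul_comm]

lemma charFun_convIter (ρ : ProbabilityMeasure (Rd d)) (n : ℕ) (z : Rd d) :
    charFun (convIter ρ n : Measure (Rd d)) z = charFun (ρ : Measure (Rd d)) z ^ n := by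
  induction n with
  | zero => simp [convIter, charFun_diracProba]
  | succ n ih => rw [convIter, charFun_conv_coe, ih, pow_succ]

/-- `ψ` is the exponent of the characteristic function of some distribution. -/
def IsCharExponent (ψ : Rd d → ℂ) : Prop :=
  ∃ μ : ProbabilityMeasure (Rd d), ∀ z, charFun (μ : Measure (Rd d)) z = Complex.exp (ψ z)

namespace IsCharExponent

lemma add {ψ φ : Rd d → ℂ} (hψ : IsCharExponent ψ) (hφ : IsCharExponent φ) :
    IsCharExponent (fun z => ψ z + φ z) := by
  obtain ⟨μ, hμ⟩ := hψ
  obtain ⟨ρ, hρ⟩ := hφ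
  exact ⟨conv μ ρ, fun z => by rw [charFun_conv_coe, hμ, hρ, Complex.exp_add]⟩

lemma inner_right (c : Rd d) : IsCharExponent fun z => Complex.I * (inner ℝ c z : ℝ) :=
  ⟨diracProba c, charFun_diracProba c⟩

lemma of_tendsto {ψ : ℕ → Rd d → ℂ} {φ : Rd d → ℂ} (hψ : ∀ n, IsCharExponent (ψ n))
    (hφ : Continuous φ) (h : ∀ z, Tendsto (fun n => ψ n z) atTop (𝓝 (φ z))) :
    IsCharExponent φ := by
  choose μ hμ using hψ
  refine exists_charFun_eq_of_tendsto (μ := μ) (by fun_prop) fun z => ?_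
  simp_rw [hμ]
  exact (Complex.continuous_exp.tendsto _).comp (h z)

/-- The exponent of a compound Poisson distribution. -/
lemma compoundPoisson (κ : Measure (Rd d)) [IsFiniteMeasure κ] :
    IsCharExponent fun z => charFun κ z - κ.real Set.univ := by
  obtain ⟨N, hN⟩ := exists_nat_ge (κ.real Set.univ)
  -- With λ the mass of κ, the law (1 - λ/n)δ₀ + κ/n has an `n`-fold convolution whose
  -- characteristic function is (1 + (κ̂ - λ)/n)ⁿ, which tends to the desired exponential. Taking n
  -- > N ≥ λ keeps the weight at 0 nonnegative.
  have key : ∀ n : ℕ, N < n → ∃ μ : ProbabilityMeasure (Rd d), ∀ z,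
      charFun (μ : Measure (Rd d)) z = (1 + (charFun κ z - κ.real Set.univ) / (n : ℂ)) ^ n := by
    intro n hn
    have hn0 : (0 : ℝ) < n := by exact_mod_cast (Nat.zero_le N).trans_lt hn
    have ha : 0 ≤ 1 - κ.real Set.univ / n := by
      rw [sub_nonneg, div_le_one hn0]
      exact hN.trans (by exact_mod_cast hn.le)
    let ρ : Measure (Rd d) := ENNReal.ofReal (1 - κ.real Set.univ / n) • Measure.dirac 0 +
      ENNReal.ofReal (n : ℝ)⁻¹ • κ
    have hρ : IsProbabilityMeasure ρ := by
      constructor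
      have : κ Set.univ = ENNReal.ofReal (κ.real Set.univ) := by simp
      simp only [ρ, Measure.add_apply, Measure.smul_apply, smul_eq_mul, measure_univ, mul_one]
      rw [this, ← ENNReal.ofReal_mul (by positivity), ← ENNReal.ofReal_add ha (by positivity)]
      rw [← ENNReal.ofReal_one]
      congr 1
      ring
    let P : ProbabilityMeasure (Rd d) := ⟨ρ, hρ⟩
    refine ⟨convIter P n, fun z => ?_⟩
    rw [charFun_convIter]
    congr 1
    change charFun ρ z = _
    have hi (κ' : Measure (Rd d)) [IsFiniteMeasure κ'] :
        Integrable (fun x : Rd d => Complex.exp ((inner ℝ x z : ℝ) * Complex.I)) κ' :=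
      Integrable.of_bound (by fun_prop) 1 (ae_of_all _ fun x => by
        rw [Complex.norm_exp_ofReal_mul_I])
    rw [charFun_apply, integral_add_measure ((hi _).smul_measure ENNReal.ofReal_ne_top)
      ((hi _).smul_measure ENNReal.ofReal_ne_top), integral_smul_measure, integral_smul_measure,
      integral_dirac, ENNReal.toReal_ofReal ha, ENNReal.toReal_ofReal (by positivity),
      ← charFun_apply]
    simp only [inner_zero_left, Complex.ofReal_zero, zero_mul, Complex.exp_zero,
      Complex.real_smul]
    push_cast
    ring
  choose! μ hμ using key
  refine exists_charFun_eq_of_tendsto (μ := fun n => μ (n + (N + 1))) (by fun_prop) fun z => ?_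
  refine Tendsto.congr (fun n => (hμ _ (by omega) z).symm) ?_
  exact (tendsto_add_atTop_iff_nat (N + 1)).2
    (Complex.tendsto_one_add_div_pow_exp (charFun κ z - κ.real Set.univ))

end IsCharExponent

lemma IsLevyMeasure.measure_lt_norm_lt_top {ν : Measure (Rd d)} (hν : IsLevyMeasure ν) {ε : ℝ}
    (hε : 0 < ε) : ν {x | ε < ‖x‖} < ∞ := by
  have := (hν.integrable_sqMin).measure_gt_lt_top (ε := min (ε ^ 2) 1 / 2) (by positivity)
  refine (measure_mono fun x hx => ?_).trans_lt this
  have hx' : ε < ‖x‖ := hx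
  have h1 : min (ε ^ 2) 1 ≤ sqMin x := min_le_min (by gcongr) le_rfl
  have h2 : 0 < min (ε ^ 2) 1 := by positivity
  change _ < sqMin x
  linarith

/-- Removing the jumps of size at most 1/(n+1) leaves a finite jump measure, whose exponent is
compound Poisson plus a linear compensator. These exponents converge to the full jump integral by
dominated convergence. -/
lemma isCharExponent_levyExponent {ν : Measure (Rd d)} (hν : IsLevyMeasure ν) (γ : Rd d) :
    IsCharExponent (levyExponent 0 ν γ) := by
  have h0 : IsCharExponent fun z => ∫ x, levyIntegrand z x ∂ν := by
    let s : ℕ → Set (Rd d) := fun n => {x | 1 / ((n : ℝ) + 1) < ‖x‖}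
    have hs : ∀ n, MeasurableSet (s n) := fun n => measurableSet_lt measurable_const measurable_norm
    refine IsCharExponent.of_tendsto (ψ := fun n z => ∫ x in s n, levyIntegrand z x ∂ν) ?_
      (continuous_integral_levyIntegrand hν) ?_
    · intro n
      have : IsFiniteMeasure (ν.restrict (s n)) :=
        isFiniteMeasure_restrict.2 (hν.measure_lt_norm_lt_top (by positivity)).ne
      set κ := ν.restrict (s n)
      let c : Rd d := ∫ x in Metric.closedBall 0 1, x ∂κ
      convert (IsCharExponent.compoundPoisson κ).add (IsCharExponent.inner_right (-c)) using 2 with z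
      have hx : IntegrableOn (fun x : Rd d => x) (Metric.closedBall 0 1) κ :=
        Measure.integrableOn_of_bounded (M := 1) (measure_ne_top _ _) (by fun_prop)
          (by filter_upwards [ae_restrict_mem measurableSet_closedBall] with x hx; simpa using hx)
      have h1 : Integrable (fun x : Rd d => Complex.exp (Complex.I * (inner ℝ z x : ℝ))) κ :=
        Integrable.of_bound (by fun_prop) 1 (ae_of_all _ fun x => by
          rw [Complex.norm_exp_I_mul_ofReal])
      have h2 : Integrable (fun x : Rd d => Complex.exp (Complex.I * (inner ℝ z x : ℝ)) - 1) κ :=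
        h1.sub (integrable_const _)
      have h3 : Integrable (fun x : Rd d => (Metric.closedBall (0 : Rd d) 1).indicator
          (fun x => Complex.I * (inner ℝ z x : ℝ)) x) κ := by
        rw [integrable_indicator_iff measurableSet_closedBall]
        exact ((hx.const_inner z).ofReal).const_mul _
      have h4 : ∀ x, levyIntegrand z x = Complex.exp (Complex.I * (inner ℝ z x : ℝ)) - 1 -
          (Metric.closedBall (0 : Rd d) 1).indicator (fun x => Complex.I * (inner ℝ z x : ℝ)) x := by
        intro x
        by_cases hx : x ∈ Metric.closedBall (0 : Rd d) 1 <;> simp [levyIntegrand, hx]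
      simp_rw [h4]
      rw [integral_sub h2 h3, integral_sub h1 (integrable_const _),
        integral_indicator measurableSet_closedBall, integral_const_mul, integral_complex_ofReal,
        integral_inner hx]
      simp only [charFun_apply, real_inner_comm z, integral_const, c]
      simp [mul_comm, sub_eq_add_neg]
    · intro z
      simp_rw [← integral_indicator (hs _)]
      refine tendsto_integral_of_dominated_convergence (fun x => ‖levyIntegrand z x‖)
        (fun n => ((measurable_levyIntegrand z).indicator (hs n)).aestronglyMeasurable)
        (integrable_levyIntegrand hν z).norm
        (fun n => ae_of_all _ fun x => norm_indicator_le_norm_self _ _) ?_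
      filter_upwards [hν.ae_ne_zero] with x hx
      refine tendsto_const_nhds.congr' ?_
      filter_upwards [(tendsto_one_div_add_atTop_nhds_zero_nat (𝕜 := ℝ)).eventually_lt_const
        (norm_pos_iff.2 hx)] with n hn
      rw [Set.indicator_of_mem]
      exact hn
  convert h0.add (IsCharExponent.inner_right γ) using 2 with z
  simp [levyExponent, quadForm]

/-- Existence part of the Lévy–Khintchine theorem, without Gaussian part. -/
lemma exists_hasTriplet {ν : Measure (Rd d)} (hν : IsLevyMeasure ν) (γ : Rd d) :
    ∃ μ : ProbabilityMeasure (Rd d), HasTriplet μ 0 ν γ := by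
  obtain ⟨μ, hμ⟩ := isCharExponent_levyExponent hν γ
  exact ⟨μ, .zero, hν, hμ⟩

lemma IsLevyMeasure.add {ν ν' : Measure (Rd d)} (hν : IsLevyMeasure ν) (hν' : IsLevyMeasure ν') :
    IsLevyMeasure (ν + ν') := by
  refine ⟨by simp [hν.1, hν'.1], ?_⟩
  rw [lintegral_add_measure]
  exact ENNReal.add_lt_top.2 ⟨hν.2, hν'.2⟩

lemma IsLevyMeasure.smul {ν : Measure (Rd d)} (hν : IsLevyMeasure ν) (s : ℝ) :
    IsLevyMeasure (ENNReal.ofReal s • ν) := by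
  refine ⟨by simp [hν.1], ?_⟩
  rw [lintegral_smul_measure]
  exact ENNReal.mul_lt_top ENNReal.ofReal_lt_top hν.2

lemma isLevyMeasure_zero : IsLevyMeasure (0 : Measure (Rd d)) := ⟨by simp, by simp⟩

lemma levyExponent_add {ν ν' : Measure (Rd d)} (hν : IsLevyMeasure ν) (hν' : IsLevyMeasure ν')
    (γ γ' z : Rd d) :
    levyExponent 0 (ν + ν') (γ + γ') z = levyExponent 0 ν γ z + levyExponent 0 ν' γ' z := by
  simp only [levyExponent, quadForm]
  rw [integral_add_measure (integrable_levyIntegrand hν z) (integrable_levyIntegrand hν' z),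
    inner_add_left]
  simp
  ring

lemma levyExponent_smul {s : ℝ} (hs : 0 ≤ s) (ν : Measure (Rd d)) (γ z : Rd d) :
    levyExponent 0 (ENNReal.ofReal s • ν) (s • γ) z = s * levyExponent 0 ν γ z := by
  simp only [levyExponent, quadForm]
  rw [integral_smul_measure, ENNReal.toReal_ofReal hs, real_inner_smul_left]
  simp
  ring

namespace HasTriplet

variable {μ μ₁ μ₂ : ProbabilityMeasure (Rd d)} {ν ν₁ ν₂ : Measure (Rd d)} {γ γ₁ γ₂ : Rd d}

lemma conv (h₁ : HasTriplet μ₁ 0 ν₁ γ₁) (h₂ : HasTriplet μ₂ 0 ν₂ γ₂) :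
    HasTriplet (conv μ₁ μ₂) 0 (ν₁ + ν₂) (γ₁ + γ₂) where
  posSemidef := .zero
  isLevyMeasure := h₁.isLevyMeasure.add h₂.isLevyMeasure
  charFun_eq z := by
    change _ = Complex.exp (levyExponent 0 _ _ z)
    rw [charFun_conv_coe, h₁.charFun_eq_exp, h₂.charFun_eq_exp, ← Complex.exp_add,
      levyExponent_add h₁.isLevyMeasure h₂.isLevyMeasure]

/-- The `n`-th root is the law with triplet (0, ν/n, γ/n), so infinite divisibility comes for free
from a triplet. -/
lemma mem_ID (h : HasTriplet μ 0 ν γ) : μ ∈ ID d := by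
  intro n hn
  have hn0 : (n : ℂ) ≠ 0 := by exact_mod_cast (Nat.one_le_iff_ne_zero.1 hn)
  obtain ⟨ρ, hρ⟩ := exists_hasTriplet (h.isLevyMeasure.smul (n : ℝ)⁻¹) ((n : ℝ)⁻¹ • γ)
  refine ⟨ρ, eq_of_charFun_eq fun z => ?_⟩
  rw [charFun_convIter, hρ.charFun_eq_exp, h.charFun_eq_exp, levyExponent_smul (by positivity),
    ← Complex.exp_nat_mul]
  push_cast
  rw [mul_inv_cancel_left₀ hn0]

lemma mem_ID0 (h : HasTriplet μ 0 ν γ) : μ ∈ ID0 d := ⟨h.mem_ID, ν, γ, h⟩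

end HasTriplet

lemma hasTriplet_diracProba (c : Rd d) : HasTriplet (diracProba c) 0 0 c where
  posSemidef := .zero
  isLevyMeasure := isLevyMeasure_zero
  charFun_eq z := by rw [charFun_diracProba]; simp [quadForm]

/-! ### A bounded weight comparable with |x|² ∧ 1 -/

/-- The constant 1/20 leaves room for one value to cover three ranges: the Taylor bound on (0,1],
the Lipschitz bound from sin 1 on (1,2], and sin u ≤ 1 beyond 2. -/
lemma sub_sinc_lower (u : ℝ) : min (u ^ 2) 1 / 20 ≤ 1 - Real.sinc u := by
  wlog hu : 0 ≤ u generalizing u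
  · simpa using this (-u) (by linarith)
  rcases hu.eq_or_lt with rfl | hu
  · simp
  rw [Real.sinc_of_ne_zero hu.ne', le_sub_comm, div_le_iff₀ hu]
  rcases le_or_gt u 1 with h1 | h1
  · rw [min_eq_left (by nlinarith)]
    have h := (abs_le.1 (Real.sin_bound (x := u) (by rwa [abs_of_pos hu]))).2
    rw [abs_of_pos hu] at h
    have h3 : u ^ 4 ≤ u ^ 3 := by nlinarith [pow_pos hu 3]
    nlinarith [pow_pos hu 3]
  · rw [min_eq_right (by nlinarith)]
    have h := (abs_le.1 (Real.sin_bound (x := 1) (by simp))).2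
    have h2 : Real.sin u ≤ Real.sin 1 + (u - 1) := by
      have := Real.abs_sin_sub_sin_le u 1
      rw [abs_of_pos (by linarith : (0 : ℝ) < u - 1)] at this
      linarith [le_abs_self (Real.sin u - Real.sin 1)]
    rcases le_or_gt u 2 with h3 | h3
    · norm_num at h ⊢
      linarith
    · linarith [Real.sin_le_one u]

lemma one_sub_cos_le (u : ℝ) : 1 - Real.cos u ≤ 2 * min (u ^ 2) 1 := by
  rcases le_total (u ^ 2) 1 with h | h
  · rw [min_eq_left h]
    nlinarith [Real.one_sub_sq_div_two_le_cos (x := u)]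
  · rw [min_eq_right h]
    linarith [Real.neg_one_le_cos u]

lemma min_mul_sq_le (t u : ℝ) : min ((t * u) ^ 2) 1 ≤ (1 + t ^ 2) * min (u ^ 2) 1 := by
  rcases le_total (u ^ 2) 1 with h | h
  · rw [min_eq_left h]
    exact (min_le_left _ _).trans (by nlinarith [sq_nonneg u])
  · rw [min_eq_right h]
    exact (min_le_right _ _).trans (by nlinarith [sq_nonneg t])

lemma integral_one_sub_cos (u : ℝ) : ∫ t in (0 : ℝ)..1, (1 - Real.cos (t * u)) = 1 - Real.sinc u := by
  rw [intervalIntegral.integral_sub (by simp) (by apply Continuous.intervalIntegrable; fun_prop)]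
  rcases eq_or_ne u 0 with rfl | hu
  · simp
  · rw [intervalIntegral.integral_comp_mul_right (f := Real.cos) hu, Real.sinc_of_ne_zero hu]
    simp [div_eq_inv_mul]

lemma sub_sinc_upper (u : ℝ) : 1 - Real.sinc u ≤ 4 * min (u ^ 2) 1 := by
  rw [← integral_one_sub_cos]
  have : ∫ t in (0 : ℝ)..1, (1 - Real.cos (t * u)) ≤ ∫ _t in (0 : ℝ)..1, 4 * min (u ^ 2) 1 := by
    refine intervalIntegral.integral_mono_on zero_le_one
      (by apply Continuous.intervalIntegrable; fun_prop) (by simp) fun t ht => ?_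
    refine (one_sub_cos_le _).trans ?_
    have h1 := min_mul_sq_le t u
    have h2 : 0 ≤ min (u ^ 2) 1 := by positivity
    nlinarith [mul_nonneg (by nlinarith [ht.1, ht.2] : 0 ≤ 1 - t ^ 2) h2]
  simpa using this

lemma coord_sq_le (x : Rd d) (j : Fin d) : x j ^ 2 ≤ ‖x‖ ^ 2 := by
  rw [EuclideanSpace.real_norm_sq_eq]
  exact Finset.single_le_sum (f := fun j => x j ^ 2) (fun i _ => sq_nonneg _) (Finset.mem_univ j)

lemma min_coord_le (x : Rd d) (j : Fin d) : min (x j ^ 2) 1 ≤ sqMin x :=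
  min_le_min (coord_sq_le x j) le_rfl

lemma sqMin_le_sum (x : Rd d) : sqMin x ≤ ∑ j, min (x j ^ 2) 1 := by
  by_cases h : ∃ j, 1 ≤ x j ^ 2
  · obtain ⟨j, hj⟩ := h
    refine (min_le_right _ _).trans ((min_eq_right hj).ge.trans ?_)
    exact Finset.single_le_sum (f := fun j => min (x j ^ 2) 1) (fun i _ => by positivity)
      (Finset.mem_univ j)
  · push Not at h
    refine (min_le_left _ _).trans ?_
    rw [EuclideanSpace.real_norm_sq_eq]
    exact Finset.sum_le_sum fun j _ => (min_eq_left (h j).le).ge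

/-- The weight `∑ j, (1 - sinc xⱼ)`, comparable with `|x|² ∧ 1`. -/
def weight (x : Rd d) : ℝ := ∑ j, (1 - Real.sinc (x j))

lemma continuous_weight : Continuous (weight : Rd d → ℝ) := by
  have := Real.continuous_sinc
  unfold weight
  fun_prop

lemma weight_nonneg (x : Rd d) : 0 ≤ weight x :=
  Finset.sum_nonneg fun _ _ => sub_nonneg.2 (Real.sinc_le_one _)

lemma sqMin_le_weight (x : Rd d) : sqMin x ≤ 20 * weight x := by
  refine (sqMin_le_sum x).trans ?_
  rw [weight, Finset.mul_sum]
  exact Finset.sum_le_sum fun j _ => by linarith [sub_sinc_lower (x j)]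

lemma weight_pos {x : Rd d} (hx : x ≠ 0) : 0 < weight x := by
  linarith [sqMin_le_weight x, sqMin_pos hx]

lemma weight_le (x : Rd d) : weight x ≤ 4 * d * sqMin x := by
  have : weight x ≤ ∑ _j : Fin d, 4 * sqMin x :=
    Finset.sum_le_sum fun j _ => (sub_sinc_upper (x j)).trans (by linarith [min_coord_le x j])
  refine this.trans_eq ?_
  simp
  ring

/-- The finite measure with density `weight` with respect to `ν`. -/
def weighted (ν : Measure (Rd d)) : Measure (Rd d) :=
  ν.withDensity fun x => ENNReal.ofReal (weight x)

lemma measurable_ofReal_weight : Measurable fun x : Rd d => ENNReal.ofReal (weight x) :=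
  continuous_weight.measurable.ennreal_ofReal

namespace IsLevyMeasure

variable {ν : Measure (Rd d)}

lemma integrable_weight (hν : IsLevyMeasure ν) : Integrable weight ν :=
  (hν.integrable_sqMin.const_mul (4 * d)).mono' continuous_weight.aestronglyMeasurable
    (ae_of_all _ fun x => by
      rw [Real.norm_of_nonneg (weight_nonneg x)]
      exact weight_le x)

lemma isFiniteMeasure_weighted (hν : IsLevyMeasure ν) : IsFiniteMeasure (weighted ν) :=
  isFiniteMeasure_withDensity_ofReal hν.integrable_weight.2

/-- The weight vanishes only at 0, which ν does not charge, so passing to the finite measure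
`weighted ν` loses nothing. -/
lemma withDensity_inv_weighted (hν : IsLevyMeasure ν) :
    (weighted ν).withDensity (fun x => (ENNReal.ofReal (weight x))⁻¹) = ν :=
  withDensity_inv_same₀ measurable_ofReal_weight.aemeasurable
    (by filter_upwards [hν.ae_ne_zero] with x hx; simpa using weight_pos hx)
    (ae_of_all _ fun _ => ENNReal.ofReal_ne_top)

lemma weighted_singleton_zero (hν : IsLevyMeasure ν) : weighted ν {0} = 0 :=
  withDensity_absolutelyContinuous _ _ hν.1

/-- Integration against `ν` in terms of its weighted version. -/
lemma integral_eq_weighted (hν : IsLevyMeasure ν) (f : Rd d → ℂ) :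
    ∫ x, f x ∂ν = ∫ x, ((weight x)⁻¹ : ℝ) • f x ∂(weighted ν) := by
  rw [weighted, integral_withDensity_eq_integral_toReal_smul measurable_ofReal_weight
    (ae_of_all _ fun _ => ENNReal.ofReal_lt_top)]
  refine integral_congr_ae ?_
  filter_upwards [hν.ae_ne_zero] with x hx
  rw [ENNReal.toReal_ofReal (weight_nonneg x), smul_smul, mul_inv_cancel₀ (weight_pos hx).ne',
    one_smul]

end IsLevyMeasure

/-! ### Second differences of the exponent and uniqueness of the triplet -/

/-- The symmetric second difference of `Ψ` in the `j`-th coordinate direction. -/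
def secondDiff (Ψ : Rd d → ℂ) (j : Fin d) (z : Rd d) (t : ℝ) : ℂ :=
  Ψ z - (Ψ (z + t • EuclideanSpace.single j 1) + Ψ (z - t • EuclideanSpace.single j 1)) / 2

lemma inner_smul_single (t : ℝ) (j : Fin d) (x : Rd d) :
    inner ℝ (t • EuclideanSpace.single j (1 : ℝ)) x = t * x j := by
  rw [real_inner_smul_left, EuclideanSpace.inner_single_left]; simp

/-- The constant and the compensator are affine in `z`, so they cancel whatever the truncation; only
the exponential survives. -/
lemma levyIntegrand_secondDiff (z x : Rd d) (j : Fin d) (t : ℝ) :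
    secondDiff (fun z => levyIntegrand z x) j z t =
      Complex.exp (Complex.I * (inner ℝ z x : ℝ)) * ((1 - Real.cos (t * x j) : ℝ) : ℂ) := by
  simp only [secondDiff, levyIntegrand, inner_add_left, inner_sub_left, inner_smul_single]
  push_cast
  rw [Complex.cos, mul_add, mul_sub, Complex.exp_add, sub_eq_add_neg (Complex.I * _),
    Complex.exp_add]
  rw [show -(Complex.I * (t * x j : ℂ)) = -(t * x j : ℂ) * Complex.I by ring,
    show Complex.I * (t * x j : ℂ) = (t * x j : ℂ) * Complex.I by ring]
  ring

lemma secondDiff_quadForm (A : Matrix (Fin d) (Fin d) ℝ) (z v : Rd d) :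
    quadForm A z - (quadForm A (z + v) + quadForm A (z - v)) / 2 = - quadForm A v := by
  simp only [quadForm, map_add, map_sub, inner_add_left, inner_add_right, inner_sub_left,
    inner_sub_right]
  ring

lemma quadForm_smul (A : Matrix (Fin d) (Fin d) ℝ) (t : ℝ) (v : Rd d) :
    quadForm A (t • v) = t ^ 2 * quadForm A v := by
  simp only [quadForm, map_smul, real_inner_smul_left, real_inner_smul_right]
  ring

lemma levyExponent_secondDiff {ν : Measure (Rd d)} (hν : IsLevyMeasure ν)
    (A : Matrix (Fin d) (Fin d) ℝ) (γ z : Rd d) (j : Fin d) (t : ℝ) :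
    secondDiff (levyExponent A ν γ) j z t =
      ((t ^ 2 * (quadForm A (EuclideanSpace.single j 1) / 2) : ℝ) : ℂ) +
      ∫ x, Complex.exp (Complex.I * (inner ℝ z x : ℝ)) * ((1 - Real.cos (t * x j) : ℝ) : ℂ) ∂ν := by
  simp_rw [← levyIntegrand_secondDiff]
  set v : Rd d := t • EuclideanSpace.single j 1 with hv
  have hi := integrable_levyIntegrand hν
  have h1 : ∫ x, secondDiff (fun z => levyIntegrand z x) j z t ∂ν =
      ∫ x, levyIntegrand z x ∂ν - (∫ x, levyIntegrand (z + v) x ∂ν +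
        ∫ x, levyIntegrand (z - v) x ∂ν) / 2 := by
    rw [← integral_add (hi _) (hi _), ← integral_div, ← integral_sub (hi _)]
    · rfl
    · exact ((hi (z + v)).add (hi (z - v))).div_const 2
  rw [h1]
  have h2 := congrArg (fun r : ℝ => (r : ℂ)) (secondDiff_quadForm A z v)
  rw [hv, quadForm_smul, ← hv] at h2
  simp only [secondDiff, levyExponent, inner_add_right, inner_sub_right, ← hv]
  push_cast at h2 ⊢
  linear_combination (-1 / 2 : ℂ) * h2

lemma norm_exp_mul_ofReal (z x : Rd d) (r : ℝ) :
    ‖Complex.exp (Complex.I * (inner ℝ z x : ℝ)) * (r : ℂ)‖ = |r| := by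
  rw [norm_mul, Complex.norm_exp_I_mul_ofReal, one_mul, Complex.norm_real, Real.norm_eq_abs]

/-- Fubini in (t, x), dominated by 2(1+t²)(|x|² ∧ 1). The factor 1/6 is the 1/2 of the Gaussian term
times ∫₀¹ t² dt. -/
lemma integral_levyExponent_secondDiff {ν : Measure (Rd d)} (hν : IsLevyMeasure ν)
    (A : Matrix (Fin d) (Fin d) ℝ) (γ z : Rd d) (j : Fin d) :
    ∫ t in (0 : ℝ)..1, secondDiff (levyExponent A ν γ) j z t =
      ((quadForm A (EuclideanSpace.single j 1) / 6 : ℝ) : ℂ) +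
      ∫ x, Complex.exp (Complex.I * (inner ℝ z x : ℝ)) * ((1 - Real.sinc (x j) : ℝ) : ℂ) ∂ν := by
  have := hν.sigmaFinite
  simp_rw [levyExponent_secondDiff hν]
  have hint : Integrable (Function.uncurry fun (t : ℝ) (x : Rd d) =>
      Complex.exp (Complex.I * (inner ℝ z x : ℝ)) * ((1 - Real.cos (t * x j) : ℝ) : ℂ))
      ((volume.restrict (Set.uIoc 0 1)).prod ν) := by
    have hb : Integrable (fun p : ℝ × Rd d => (2 * (1 + p.1 ^ 2)) * sqMin p.2)
        ((volume.restrict (Set.uIoc 0 1)).prod ν) :=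
      Integrable.mul_prod (f := fun t : ℝ => 2 * (1 + t ^ 2))
        (Continuous.integrableOn_uIoc (by fun_prop)) hν.integrable_sqMin
    refine hb.mono' (Measurable.aestronglyMeasurable (by unfold Function.uncurry; fun_prop))
      (ae_of_all _ fun p => ?_)
    simp only [Function.uncurry]
    rw [norm_exp_mul_ofReal, abs_of_nonneg (by linarith [Real.cos_le_one (p.1 * p.2 j)])]
    refine (one_sub_cos_le _).trans ?_
    have h1 := min_mul_sq_le p.1 (p.2 j)
    have h2 := min_coord_le p.2 j
    have : (1 + p.1 ^ 2) * min (p.2 j ^ 2) 1 ≤ (1 + p.1 ^ 2) * sqMin p.2 := by gcongr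
    linarith
  rw [intervalIntegral.integral_add]
  · congr 1
    · rw [intervalIntegral.integral_ofReal, intervalIntegral.integral_mul_const, integral_pow]
      congr 1
      norm_num
      ring
    · rw [intervalIntegral_integral_swap hint]
      congr 1
      ext x
      rw [intervalIntegral.integral_const_mul, intervalIntegral.integral_ofReal,
        integral_one_sub_cos]
  · apply Continuous.intervalIntegrable; fun_prop
  · rw [intervalIntegrable_iff]
    exact hint.integral_prod_left

/-- The key identity: an operation on the exponent alone yields the characteristic function of a
finite measure, the Gaussian part appearing as that of a point mass at 0. -/
lemma sum_integral_secondDiff {ν : Measure (Rd d)} (hν : IsLevyMeasure ν)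
    (A : Matrix (Fin d) (Fin d) ℝ) (γ z : Rd d) :
    ∑ j, ∫ t in (0 : ℝ)..1, secondDiff (levyExponent A ν γ) j z t =
      ((∑ j, quadForm A (EuclideanSpace.single j 1) / 6 : ℝ) : ℂ) + charFun (weighted ν) z := by
  simp_rw [integral_levyExponent_secondDiff hν, Finset.sum_add_distrib]
  push_cast
  congr 1
  rw [charFun_apply, weighted, integral_withDensity_eq_integral_toReal_smul measurable_ofReal_weight
    (ae_of_all _ fun _ => ENNReal.ofReal_lt_top), ← integral_finsetSum]
  · refine integral_congr_ae (ae_of_all _ fun x => ?_)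
    simp only
    rw [ENNReal.toReal_ofReal (weight_nonneg x), weight, real_inner_comm, Complex.real_smul,
      Complex.ofReal_sum, Finset.sum_mul]
    refine Finset.sum_congr rfl fun j _ => ?_
    push_cast
    ring_nf
  · intro j _
    refine (hν.integrable_sqMin.const_mul 4).mono' ?_ (ae_of_all _ fun x => ?_)
    · have := Real.continuous_sinc
      exact Continuous.aestronglyMeasurable (by fun_prop)
    · have := norm_exp_mul_ofReal z x (1 - Real.sinc (x j))
      push_cast at this
      rw [this, abs_of_nonneg (by linarith [Real.sinc_le_one (x j)])]
      exact (sub_sinc_upper _).trans (by linarith [min_coord_le x j])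

lemma charFun_add_smul_dirac (κ : Measure (Rd d)) [IsFiniteMeasure κ] {c : ℝ} (hc : 0 ≤ c)
    (z : Rd d) : charFun (κ + ENNReal.ofReal c • Measure.dirac 0) z = charFun κ z + c := by
  have hi (κ' : Measure (Rd d)) [IsFiniteMeasure κ'] :
      Integrable (fun x : Rd d => Complex.exp ((inner ℝ x z : ℝ) * Complex.I)) κ' :=
    Integrable.of_bound (by fun_prop) 1 (ae_of_all _ fun x => by
      rw [Complex.norm_exp_ofReal_mul_I])
  rw [charFun_apply, integral_add_measure (hi _)
    ((hi _).smul_measure ENNReal.ofReal_ne_top), integral_smul_measure,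
    integral_dirac, ENNReal.toReal_ofReal hc, ← charFun_apply]
  simp

lemma quadForm_nonneg {A : Matrix (Fin d) (Fin d) ℝ} (hA : A.PosSemidef) (z : Rd d) :
    0 ≤ quadForm A z := by
  have := hA.dotProduct_mulVec_nonneg z.ofLp
  simp only [quadForm, PiLp.inner_apply, Matrix.toLpLin_apply]
  simpa [dotProduct, mul_comm] using this

lemma eq_zero_of_quadForm_eq_zero {A : Matrix (Fin d) (Fin d) ℝ} (hA : A.PosSemidef)
    (h : ∀ z, quadForm A z = 0) : A = 0 := by
  have h1 : ∀ v : Fin d → ℝ, A.mulVec v = 0 := fun v => by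
    rw [← hA.dotProduct_mulVec_zero_iff]
    have := h (WithLp.toLp 2 v)
    simp only [quadForm, PiLp.inner_apply, Matrix.toLpLin_apply] at this
    simpa [dotProduct, mul_comm] using this
  ext i j
  simpa using congrFun (h1 (Pi.single j 1)) i

/-- The second matrix is left arbitrary because the triplet selected by `Classical.epsilon` is not
known beforehand to have zero Gaussian part. -/
lemma HasTriplet.unique {μ : ProbabilityMeasure (Rd d)} {A : Matrix (Fin d) (Fin d) ℝ}
    {ν ν' : Measure (Rd d)} {γ γ' : Rd d} (h : HasTriplet μ 0 ν γ) (h' : HasTriplet μ A ν' γ') :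
    A = 0 ∧ ν' = ν ∧ γ' = γ := by
  have hψ : levyExponent 0 ν γ = levyExponent A ν' γ' :=
    eq_of_exp_eq h.continuous_exponent h'.continuous_exponent (levyExponent_zero _ _ _)
      (levyExponent_zero _ _ _) fun z => by rw [← h.charFun_eq_exp, ← h'.charFun_eq_exp]
  have hν := h.isLevyMeasure
  have hν' := h'.isLevyMeasure
  have := hν.isFiniteMeasure_weighted
  have := hν'.isFiniteMeasure_weighted
  have hc : 0 ≤ ∑ j, quadForm A (EuclideanSpace.single j 1) / 6 :=
    Finset.sum_nonneg fun j _ => by linarith [quadForm_nonneg h'.posSemidef (EuclideanSpace.single j 1)]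
  set c := ∑ j, quadForm A (EuclideanSpace.single j 1) / 6
  have hm : weighted ν = weighted ν' + ENNReal.ofReal c • Measure.dirac 0 := by
    have : IsFiniteMeasure (ENNReal.ofReal c • Measure.dirac (0 : Rd d)) :=
      Measure.smul_finite _ ENNReal.ofReal_ne_top
    refine Measure.ext_of_charFun (funext fun z => ?_)
    rw [charFun_add_smul_dirac _ hc, add_comm, ← sum_integral_secondDiff hν' A γ' z, ← hψ,
      sum_integral_secondDiff hν]
    simp [quadForm]
  -- Neither weighted Lévy measure charges the origin, so evaluating at {0} isolates the Gaussian
  -- mass.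
  have hc0 : ENNReal.ofReal c = 0 := by
    have := congrArg (fun m : Measure (Rd d) => m {0}) hm
    simpa [hν.weighted_singleton_zero, hν'.weighted_singleton_zero] using this.symm
  have hνν : ν' = ν := by
    rw [hc0, zero_smul, add_zero] at hm
    rw [← hν.withDensity_inv_weighted, hm, hν'.withDensity_inv_weighted]
  subst hνν
  -- With the jump integrals cancelled, the Gaussian term is real and the location term purely
  -- imaginary.
  have hz : ∀ z, quadForm A z = 0 ∧ inner ℝ γ z = (inner ℝ γ' z : ℝ) := by
    intro z
    have := congrFun hψ z
    simp only [levyExponent] at this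
    have h2 : Complex.I * (inner ℝ γ z : ℝ) =
      -(1 / 2 : ℂ) * (quadForm A z : ℝ) + Complex.I * (inner ℝ γ' z : ℝ) := by
      simp [quadForm] at this ⊢
      linear_combination this
    have hre := congrArg Complex.re h2
    have him := congrArg Complex.im h2
    simp at hre him
    exact ⟨by linarith, him⟩
  exact ⟨eq_zero_of_quadForm_eq_zero h'.posSemidef fun z => (hz z).1, rfl,
    (ext_inner_right ℝ fun z => (hz z).2).symm⟩

lemma HasTriplet.triplet_eq {μ : ProbabilityMeasure (Rd d)} {ν : Measure (Rd d)} {γ : Rd d}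
    (h : HasTriplet μ 0 ν γ) : triplet μ = (0, ν, γ) := by
  have h' : HasTriplet μ (triplet μ).1 (triplet μ).2.1 (triplet μ).2.2 :=
    Classical.epsilon_spec (p := fun t : Matrix (Fin d) (Fin d) ℝ × Measure (Rd d) × Rd d =>
      HasTriplet μ t.1 t.2.1 t.2.2) ⟨(0, ν, γ), h⟩
  obtain ⟨h1, h2, h3⟩ := h.unique h'
  exact Prod.ext h1 (Prod.ext h2 h3)

lemma HasTriplet.gaussCov_eq {μ : ProbabilityMeasure (Rd d)} {ν : Measure (Rd d)} {γ : Rd d}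
    (h : HasTriplet μ 0 ν γ) : gaussCov μ = 0 := by rw [gaussCov, h.triplet_eq]

lemma HasTriplet.levyMeasure_eq {μ : ProbabilityMeasure (Rd d)} {ν : Measure (Rd d)} {γ : Rd d}
    (h : HasTriplet μ 0 ν γ) : levyMeasure μ = ν := by rw [levyMeasure, h.triplet_eq]

lemma HasTriplet.location_eq {μ : ProbabilityMeasure (Rd d)} {ν : Measure (Rd d)} {γ : Rd d}
    (h : HasTriplet μ 0 ν γ) : location μ = γ := by rw [location, h.triplet_eq]

lemma hasTriplet_of_mem_ID0 {μ : ProbabilityMeasure (Rd d)} (h : μ ∈ ID0 d) :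
    HasTriplet μ 0 (levyMeasure μ) (location μ) := by
  obtain ⟨-, ν, γ, h⟩ := h
  rwa [h.levyMeasure_eq, h.location_eq]

/-! ### Inversion of Lévy measures and locations -/

lemma norm_geomInv (x : Rd d) : ‖geomInv x‖ = ‖x‖⁻¹ := by
  rcases eq_or_ne x 0 with rfl | hx
  · simp [geomInv]
  · have : ‖x‖ ≠ 0 := norm_ne_zero_iff.2 hx
    rw [geomInv, norm_smul, norm_inv, norm_pow, norm_norm]
    field_simp

lemma geomInv_geomInv (x : Rd d) : geomInv (geomInv x) = x := by
  rcases eq_or_ne x 0 with rfl | hx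
  · simp [geomInv]
  · have : ‖x‖ ≠ 0 := norm_ne_zero_iff.2 hx
    conv_lhs => rw [geomInv, norm_geomInv, geomInv, smul_smul]
    rw [inv_pow, inv_inv, mul_inv_cancel₀ (by positivity), one_smul]

lemma measurable_geomInv : Measurable (geomInv : Rd d → Rd d) := by
  unfold geomInv; fun_prop

/-- The geometric inversion as a measurable equivalence. -/
def geomInvEquiv (d : ℕ) : Rd d ≃ᵐ Rd d where
  toFun := geomInv
  invFun := geomInv
  left_inv := geomInv_geomInv
  right_inv := geomInv_geomInv
  measurable_toFun := measurable_geomInv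
  measurable_invFun := measurable_geomInv

lemma measurable_ofReal_norm_sq : Measurable fun x : Rd d => ENNReal.ofReal (‖x‖ ^ 2) := by
  fun_prop

/-- The Lévy measure of the inversion. -/
def invMeasure (ν : Measure (Rd d)) : Measure (Rd d) :=
  (ν.withDensity fun x => ENNReal.ofReal (‖x‖ ^ 2)).map (geomInvEquiv d)

lemma lintegral_invMeasure (ν : Measure (Rd d)) {f : Rd d → ℝ≥0∞} (hf : Measurable f) :
    ∫⁻ x, f x ∂(invMeasure ν) = ∫⁻ x, ENNReal.ofReal (‖x‖ ^ 2) * f (geomInv x) ∂ν := by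
  rw [invMeasure, lintegral_map_equiv]
  exact lintegral_withDensity_eq_lintegral_mul ν measurable_ofReal_norm_sq
    (hf.comp (geomInvEquiv d).measurable)

lemma integral_invMeasure {E : Type*} [NormedAddCommGroup E] [NormedSpace ℝ E]
    (ν : Measure (Rd d)) (f : Rd d → E) :
    ∫ x, f x ∂(invMeasure ν) = ∫ x, ‖x‖ ^ 2 • f (geomInv x) ∂ν := by
  rw [invMeasure, integral_map_equiv, integral_withDensity_eq_integral_toReal_smul
    measurable_ofReal_norm_sq (ae_of_all _ fun _ => ENNReal.ofReal_lt_top)]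
  refine integral_congr_ae (ae_of_all _ fun x => ?_)
  simp only
  rw [ENNReal.toReal_ofReal (by positivity)]
  rfl

lemma invMeasure_apply (ν : Measure (Rd d)) {B : Set (Rd d)} (hB : MeasurableSet B) :
    invMeasure ν B =
      ∫⁻ x, B.indicator (fun _ => 1) (geomInv x) * ENNReal.ofReal (‖x‖ ^ 2) ∂ν := by
  rw [← lintegral_indicator_one hB, lintegral_invMeasure ν (measurable_one.indicator hB)]
  simp_rw [mul_comm]
  rfl

lemma norm_sq_mul_sqMin_geomInv (x : Rd d) : ‖x‖ ^ 2 * sqMin (geomInv x) = sqMin x := by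
  rcases eq_or_ne x 0 with rfl | hx
  · simp [sqMin]
  · have : ‖x‖ ≠ 0 := norm_ne_zero_iff.2 hx
    rw [sqMin, sqMin, norm_geomInv, mul_min_of_nonneg _ _ (by positivity), min_comm, inv_pow,
      mul_inv_cancel₀ (by positivity), mul_one]

lemma norm_sq_mul_norm_geomInv_sq {x : Rd d} (hx : x ≠ 0) : ‖x‖ ^ 2 * ‖geomInv x‖ ^ 2 = 1 := by
  have : ‖x‖ ≠ 0 := norm_ne_zero_iff.2 hx
  rw [norm_geomInv, inv_pow, mul_inv_cancel₀ (by positivity)]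

lemma isLevyMeasure_invMeasure {ν : Measure (Rd d)} (hν : IsLevyMeasure ν) :
    IsLevyMeasure (invMeasure ν) := by
  constructor
  · rw [invMeasure_apply ν (measurableSet_singleton 0), lintegral_eq_zero_iff']
    · filter_upwards [hν.ae_ne_zero] with x hx
      have : geomInv x ≠ 0 := by rw [← norm_ne_zero_iff, norm_geomInv]; simpa using hx
      simp [this]
    · exact ((measurable_const.indicator (measurableSet_singleton 0)).comp
        measurable_geomInv).aemeasurable.mul measurable_ofReal_norm_sq.aemeasurable
  · have := lintegral_invMeasure ν (f := fun x => ENNReal.ofReal (sqMin x))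
      measurable_sqMin.ennreal_ofReal
    simp_rw [← ENNReal.ofReal_mul (sq_nonneg ‖_‖), norm_sq_mul_sqMin_geomInv] at this
    exact this.trans_lt hν.2

/-- The two densities multiply to |ι(x)|²|x|² = 1 away from 0. The hypothesis matters at the origin,
where the density |x|² would erase an atom. -/
lemma invMeasure_invMeasure {ν : Measure (Rd d)} (hν : IsLevyMeasure ν) :
    invMeasure (invMeasure ν) = ν := by
  ext B hB
  have hm : Measurable fun x : Rd d =>
      B.indicator (fun _ => (1 : ℝ≥0∞)) (geomInv x) * ENNReal.ofReal (‖x‖ ^ 2) :=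
    ((measurable_const.indicator hB).comp measurable_geomInv).mul measurable_ofReal_norm_sq
  rw [invMeasure_apply _ hB, lintegral_invMeasure ν hm, ← lintegral_indicator_one hB]
  refine lintegral_congr_ae ?_
  filter_upwards [hν.ae_ne_zero] with x hx
  rw [geomInv_geomInv, mul_left_comm, ← ENNReal.ofReal_mul (by positivity),
    norm_sq_mul_norm_geomInv_sq hx, ENNReal.ofReal_one, mul_one]
  rfl

lemma invMeasure_add (ν ν' : Measure (Rd d)) :
    invMeasure (ν + ν') = invMeasure ν + invMeasure ν' := by
  ext B hB
  simp [invMeasure_apply _ hB]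

lemma invMeasure_smul (c : ℝ≥0∞) (ν : Measure (Rd d)) :
    invMeasure (c • ν) = c • invMeasure ν := by
  ext B hB
  simp [invMeasure_apply _ hB]

lemma invMeasure_zero : invMeasure (0 : Measure (Rd d)) = 0 := by
  ext B hB
  simp [invMeasure_apply _ hB]

lemma geomInv_of_norm_eq_one {x : Rd d} (hx : ‖x‖ = 1) : geomInv x = x := by simp [geomInv, hx]

/-- ι fixes the unit sphere pointwise and the density |x|² is 1 there. This makes the correction in
`invLocation` cancel on a second inversion. -/
lemma setIntegral_sphere_invMeasure (ν : Measure (Rd d)) :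
    ∫ x in Metric.sphere (0 : Rd d) 1, x ∂(invMeasure ν) =
      ∫ x in Metric.sphere (0 : Rd d) 1, x ∂ν := by
  rw [← integral_indicator Metric.isClosed_sphere.measurableSet,
    ← integral_indicator Metric.isClosed_sphere.measurableSet, integral_invMeasure]
  refine integral_congr_ae (ae_of_all _ fun x => ?_)
  by_cases hx : ‖x‖ = 1
  · simp [hx, geomInv_of_norm_eq_one hx]
  · simp [hx, norm_geomInv]

/-- The location parameter of the inversion. -/
def invLocation (ν : Measure (Rd d)) (γ : Rd d) : Rd d :=
  -γ + ∫ x in Metric.sphere (0 : Rd d) 1, x ∂ν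

lemma invLocation_invLocation (ν : Measure (Rd d)) (γ : Rd d) :
    invLocation (invMeasure ν) (invLocation ν γ) = γ := by
  rw [invLocation, setIntegral_sphere_invMeasure, invLocation]
  abel

lemma IsLevyMeasure.integrableOn_sphere {ν : Measure (Rd d)} (hν : IsLevyMeasure ν) :
    IntegrableOn (fun x : Rd d => x) (Metric.sphere (0 : Rd d) 1) ν := by
  have : ν (Metric.sphere (0 : Rd d) 1) ≠ ∞ :=
    ((measure_mono fun x hx => by
      rw [mem_sphere_zero_iff_norm] at hx
      simp [hx]; norm_num).trans_lt (hν.measure_lt_norm_lt_top (ε := 1 / 2) (by norm_num))).ne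
  refine Measure.integrableOn_of_bounded (M := 1) this (by fun_prop) ?_
  filter_upwards [ae_restrict_mem Metric.isClosed_sphere.measurableSet] with x hx
  simpa using hx.le

lemma invLocation_add {ν ν' : Measure (Rd d)} (hν : IsLevyMeasure ν) (hν' : IsLevyMeasure ν')
    (γ γ' : Rd d) :
    invLocation (ν + ν') (γ + γ') = invLocation ν γ + invLocation ν' γ' := by
  rw [invLocation, Measure.restrict_add, integral_add_measure hν.integrableOn_sphere
    hν'.integrableOn_sphere, invLocation, invLocation]
  abel

lemma invLocation_smul {s : ℝ} (hs : 0 ≤ s) (ν : Measure (Rd d)) (γ : Rd d) :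
    invLocation (ENNReal.ofReal s • ν) (s • γ) = s • invLocation ν γ := by
  rw [invLocation, Measure.restrict_smul, integral_smul_measure, ENNReal.toReal_ofReal hs,
    invLocation, smul_add, smul_neg]

/-! ### Inversion, convolution and convolution powers in terms of triplets -/

namespace HasTriplet

variable {μ μ' μ₁ μ₂ : ProbabilityMeasure (Rd d)} {ν ν₁ ν₂ : Measure (Rd d)} {γ γ₁ γ₂ : Rd d}

/-- Reduces inversion to identities between pairs (ν, γ); excluding the origin in the definition is
harmless since ν({0}) = 0. -/
lemma isInversion_iff (h : HasTriplet μ 0 ν γ) :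
    IsInversion μ μ' ↔ HasTriplet μ' 0 (invMeasure ν) (invLocation ν γ) := by
  have hr : ν.restrict {(0 : Rd d)}ᶜ = ν :=
    Measure.restrict_eq_self_of_ae_mem h.isLevyMeasure.ae_ne_zero
  constructor
  · intro hi
    have h' := hasTriplet_of_mem_ID0 hi.mem'
    have h1 : levyMeasure μ' = invMeasure ν := by
      ext B hB
      rw [hi.levyMeasure_eq B hB, h.levyMeasure_eq, hr, invMeasure_apply ν hB]
    rwa [h1, hi.location_eq, h.levyMeasure_eq, h.location_eq] at h'
  · intro h'
    refine ⟨h.mem_ID0, h'.mem_ID0, fun B hB => ?_, ?_⟩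
    · rw [h'.levyMeasure_eq, h.levyMeasure_eq, hr, invMeasure_apply ν hB]
    · rw [h'.location_eq, h.levyMeasure_eq, h.location_eq, invLocation]

lemma existsUnique_isInversion (h : HasTriplet μ 0 ν γ) : ∃! μ', IsInversion μ μ' := by
  simp_rw [h.isInversion_iff]
  obtain ⟨μ', h'⟩ := exists_hasTriplet (isLevyMeasure_invMeasure h.isLevyMeasure) (invLocation ν γ)
  exact ⟨μ', h', fun ρ hρ => hρ.unique_law h'⟩

lemma inversion (h : HasTriplet μ 0 ν γ) :
    HasTriplet (inversion μ) 0 (invMeasure ν) (invLocation ν γ) :=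
  h.isInversion_iff.1 (Classical.epsilon_spec h.existsUnique_isInversion.exists)

lemma inversion_inversion (h : HasTriplet μ 0 ν γ) :
    LevyInversion.inversion (LevyInversion.inversion μ) = μ := by
  have := h.inversion.inversion
  rw [invMeasure_invMeasure h.isLevyMeasure, invLocation_invLocation] at this
  exact this.unique_law h

/-- ι carries |x| ≥ 1 onto the punctured closed unit ball, and |x|²|ι(x)|^(2-α) = |x|^α. -/
lemma lintegral_rpow_inversion (h : HasTriplet μ 0 ν γ) (α : ℝ) :
    ∫⁻ x in {x : Rd d | ‖x‖ ≤ 1}, ENNReal.ofReal (‖x‖ ^ (2 - α))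
        ∂(levyMeasure (LevyInversion.inversion μ)) =
      ∫⁻ x in {x : Rd d | 1 ≤ ‖x‖}, ENNReal.ofReal (‖x‖ ^ α) ∂(levyMeasure μ) := by
  have hs : MeasurableSet {x : Rd d | ‖x‖ ≤ 1} := measurableSet_le measurable_norm measurable_const
  have hs' : MeasurableSet {x : Rd d | 1 ≤ ‖x‖} := measurableSet_le measurable_const measurable_norm
  rw [h.inversion.levyMeasure_eq, h.levyMeasure_eq, ← lintegral_indicator hs,
    ← lintegral_indicator hs', lintegral_invMeasure ν (Measurable.indicator (by fun_prop) hs)]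
  refine lintegral_congr_ae ?_
  filter_upwards [h.isLevyMeasure.ae_ne_zero] with x hx
  have hx0 : 0 < ‖x‖ := norm_pos_iff.2 hx
  by_cases h1 : 1 ≤ ‖x‖
  · rw [Set.indicator_of_mem (show x ∈ {x : Rd d | 1 ≤ ‖x‖} from h1), Set.indicator_of_mem (by
      simpa [norm_geomInv] using inv_le_one_of_one_le₀ h1), ← ENNReal.ofReal_mul (by positivity),
      norm_geomInv, Real.inv_rpow hx0.le, ← Real.rpow_neg hx0.le, ← Real.rpow_natCast,
      ← Real.rpow_add hx0]
    congr 2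
    push_cast
    ring
  · rw [Set.indicator_of_notMem (show x ∉ {x : Rd d | 1 ≤ ‖x‖} from h1),
      Set.indicator_of_notMem, mul_zero]
    rw [Set.mem_ofPred_eq, norm_geomInv, not_le]
    exact (one_lt_inv₀ hx0).2 (not_le.1 h1)

lemma inversion_conv (h₁ : HasTriplet μ₁ 0 ν₁ γ₁) (h₂ : HasTriplet μ₂ 0 ν₂ γ₂) :
    LevyInversion.inversion (LevyInversion.conv μ₁ μ₂) =
      LevyInversion.conv (LevyInversion.inversion μ₁) (LevyInversion.inversion μ₂) := by
  have h := (h₁.conv h₂).inversion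
  rw [invMeasure_add, invLocation_add h₁.isLevyMeasure h₂.isLevyMeasure] at h
  exact h.unique_law (h₁.inversion.conv h₂.inversion)

/-- Any logarithm allowed by the definition is the Lévy–Khintchine exponent, and multiplying that by
s scales ν and γ. -/
lemma isConvPower_iff (h : HasTriplet μ 0 ν γ) {s : ℝ} (hs : 0 ≤ s) :
    IsConvPower μ s μ' ↔ HasTriplet μ' 0 (ENNReal.ofReal s • ν) (s • γ) := by
  constructor
  · rintro ⟨ψ, hψ, hψ0, h1, h2⟩
    have : ψ = levyExponent 0 ν γ := eq_of_exp_eq hψ h.continuous_exponent hψ0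
      (levyExponent_zero _ _ _) fun z => by rw [← h1, h.charFun_eq_exp]
    subst this
    exact ⟨.zero, h.isLevyMeasure.smul s, fun z => by rw [h2, ← levyExponent_smul hs]; rfl⟩
  · intro h'
    refine ⟨levyExponent 0 ν γ, h.continuous_exponent, levyExponent_zero _ _ _, h.charFun_eq_exp,
      fun z => ?_⟩
    rw [h'.charFun_eq_exp, levyExponent_smul hs]

lemma existsUnique_isConvPower (h : HasTriplet μ 0 ν γ) {s : ℝ} (hs : 0 ≤ s) :
    ∃! ρ, IsConvPower μ s ρ := by
  simp_rw [h.isConvPower_iff hs]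
  obtain ⟨ρ, hρ⟩ := exists_hasTriplet (h.isLevyMeasure.smul s) (s • γ)
  exact ⟨ρ, hρ, fun ρ' hρ' => hρ'.unique_law hρ⟩

lemma convPower (h : HasTriplet μ 0 ν γ) {s : ℝ} (hs : 0 ≤ s) :
    HasTriplet (convPower μ s) 0 (ENNReal.ofReal s • ν) (s • γ) :=
  (h.isConvPower_iff hs).1 (Classical.epsilon_spec (h.existsUnique_isConvPower hs).exists)

lemma inversion_convPower (h : HasTriplet μ 0 ν γ) {s : ℝ} (hs : 0 ≤ s) :
    LevyInversion.inversion (LevyInversion.convPower μ s) =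
      LevyInversion.convPower (LevyInversion.inversion μ) s := by
  have h' := (h.convPower hs).inversion
  rw [invMeasure_smul, invLocation_smul hs] at h'
  exact h'.unique_law (h.inversion.convPower hs)

end HasTriplet

lemma inversion_diracProba (c : Rd d) : inversion (diracProba c) = diracProba (-c) := by
  have h := (hasTriplet_diracProba c).inversion
  rw [invMeasure_zero] at h
  simp only [invLocation, Measure.restrict_zero, integral_zero_measure, add_zero] at h
  exact h.unique_law (hasTriplet_diracProba (-c))

/-! ### Weak convergence and locally uniform convergence of exponents -/

lemma tendsto_integral_of_tendsto {μs : ℕ → ProbabilityMeasure (Rd d)}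
    {μ : ProbabilityMeasure (Rd d)} (h : Tendsto μs atTop (𝓝 μ)) {f : Rd d → ℝ}
    (hf : Continuous f) {C : ℝ} (hC : ∀ x, ‖f x‖ ≤ C) :
    Tendsto (fun n => ∫ x, f x ∂(μs n : Measure (Rd d))) atTop
      (𝓝 (∫ x, f x ∂(μ : Measure (Rd d)))) :=
  (ProbabilityMeasure.tendsto_iff_forall_integral_tendsto.1 h)
    (BoundedContinuousFunction.ofNormedAddCommGroup f hf C hC)

lemma norm_charFun_sub_le (μ : Measure (Rd d)) [IsProbabilityMeasure μ] {δ : ℝ} {z z' : Rd d}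
    (h : ‖z - z'‖ ≤ δ) :
    ‖charFun μ z - charFun μ z'‖ ≤ ∫ x, min 2 (δ * ‖x‖) ∂μ := by
  have hδ : 0 ≤ δ := (norm_nonneg _).trans h
  have hi (z : Rd d) : Integrable (fun x : Rd d => Complex.exp ((inner ℝ x z : ℝ) * Complex.I)) μ :=
    Integrable.of_bound (by fun_prop) 1 (ae_of_all _ fun x => by
      rw [Complex.norm_exp_ofReal_mul_I])
  rw [charFun_apply, charFun_apply, ← integral_sub (hi z) (hi z')]
  refine norm_integral_le_of_norm_le ?_ (ae_of_all _ fun x => ?_)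
  · refine Integrable.of_bound (Continuous.aestronglyMeasurable (by fun_prop)) 2
      (ae_of_all _ fun x => ?_)
    rw [Real.norm_of_nonneg (by positivity)]
    exact min_le_left _ _
  · have : Complex.exp ((inner ℝ x z : ℝ) * Complex.I) - Complex.exp ((inner ℝ x z' : ℝ) * Complex.I)
        = Complex.exp ((inner ℝ x z' : ℝ) * Complex.I) *
          (Complex.exp (Complex.I * (inner ℝ x (z - z') : ℝ)) - 1) := by
      rw [mul_sub, mul_one, ← Complex.exp_add, inner_sub_right]
      congr 2
      push_cast
      ring
    rw [this, norm_mul, Complex.norm_exp_ofReal_mul_I, one_mul]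
    refine le_min (norm_exp_I_mul_sub_one_le_two _) ((norm_exp_I_mul_sub_one_le _).trans ?_)
    refine (abs_inner_le _ _).trans ?_
    rw [mul_comm]
    gcongr

/-- The modulus of continuity is bounded by the integral of min(2, δ|x|), a bounded continuous test
function. δ is chosen for the limit law by dominated convergence, and weak convergence transfers the
bound to large `n`. -/
lemma exists_equicontinuity_charFun {μs : ℕ → ProbabilityMeasure (Rd d)}
    {μ : ProbabilityMeasure (Rd d)} (h : Tendsto μs atTop (𝓝 μ)) {ε : ℝ} (hε : 0 < ε) :
    ∃ δ > 0, ∀ᶠ n in atTop, ∀ z z' : Rd d, ‖z - z'‖ ≤ δ →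
      ‖charFun (μs n : Measure (Rd d)) z - charFun (μs n : Measure (Rd d)) z'‖ < ε := by
  have hb (δ : ℝ) (hδ : 0 ≤ δ) (x : Rd d) : ‖min 2 (δ * ‖x‖)‖ ≤ 2 := by
    rw [Real.norm_of_nonneg (by positivity)]
    exact min_le_left _ _
  have h1 : Tendsto (fun k : ℕ => ∫ x, min 2 (1 / ((k : ℝ) + 1) * ‖x‖) ∂(μ : Measure (Rd d))) atTop
      (𝓝 (∫ _x, 0 ∂(μ : Measure (Rd d)))) := by
    refine tendsto_integral_of_dominated_convergence (fun _ => 2)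
      (fun k => Continuous.aestronglyMeasurable (by fun_prop)) (integrable_const _)
      (fun k => ae_of_all _ (hb _ (by positivity))) (ae_of_all _ fun x => ?_)
    have h2 : Tendsto (fun k : ℕ => 1 / ((k : ℝ) + 1) * ‖x‖) atTop (𝓝 (0 * ‖x‖)) :=
      tendsto_one_div_add_atTop_nhds_zero_nat.mul_const _
    simpa using (tendsto_const_nhds (x := (2 : ℝ))).min h2
  rw [integral_zero] at h1
  obtain ⟨k, hk⟩ := (h1.eventually_lt_const hε).exists
  refine ⟨1 / ((k : ℝ) + 1), by positivity, ?_⟩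
  have h3 := tendsto_integral_of_tendsto h (f := fun x => min 2 (1 / ((k : ℝ) + 1) * ‖x‖))
    (by fun_prop) (hb _ (by positivity))
  filter_upwards [h3.eventually_lt_const hk] with n hn z z' hz
  exact (norm_charFun_sub_le _ hz).trans_lt hn

lemma tendstoLocallyUniformly_charFun {μs : ℕ → ProbabilityMeasure (Rd d)}
    {μ : ProbabilityMeasure (Rd d)} (h : Tendsto μs atTop (𝓝 μ)) :
    TendstoLocallyUniformly (fun n => charFun (μs n : Measure (Rd d)))
      (charFun (μ : Measure (Rd d))) atTop := by
  rw [Metric.tendstoLocallyUniformly_iff]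
  intro ε hε z
  obtain ⟨δ, hδ, h1⟩ := exists_equicontinuity_charFun h (ε := ε / 3) (by positivity)
  have hc : ContinuousAt (charFun (μ : Measure (Rd d))) z := by fun_prop
  refine ⟨Metric.ball z δ ∩ {y | dist (charFun (μ : Measure (Rd d)) y)
    (charFun (μ : Measure (Rd d)) z) < ε / 3}, inter_mem (Metric.ball_mem_nhds z hδ)
    (hc.eventually (Metric.ball_mem_nhds _ (by positivity))), ?_⟩
  have h2 := (Metric.tendsto_nhds.1
    (ProbabilityMeasure.tendsto_iff_tendsto_charFun.1 h z)) (ε / 3) (by positivity)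
  filter_upwards [h1, h2] with n hn1 hn2 y hy
  have h3 := hn1 y z (by
    have := hy.1
    rw [mem_ball_iff_norm] at this
    exact this.le)
  have h4 : dist (charFun (μ : Measure (Rd d)) y) (charFun (μ : Measure (Rd d)) z) < ε / 3 := hy.2
  rw [← dist_eq_norm] at h3
  rw [dist_comm] at h3 hn2
  calc _ ≤ _ := dist_triangle4 _ (charFun (μ : Measure (Rd d)) z)
        (charFun (μs n : Measure (Rd d)) z) _
    _ < ε / 3 + ε / 3 + ε / 3 := by gcongr
    _ = ε := by ring

/-- Continuous logarithms converge uniformly on balls if the functions do. -/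
lemma tendstoUniformlyOn_of_exp {Ψs : ℕ → Rd d → ℂ} {Ψ : Rd d → ℂ} (hΨs : ∀ n, Continuous (Ψs n))
    (hΨ : Continuous Ψ) (hs0 : ∀ n, Ψs n 0 = 0) (h0 : Ψ 0 = 0)
    (h : TendstoLocallyUniformly (fun n z => Complex.exp (Ψs n z)) (fun z => Complex.exp (Ψ z))
      atTop) {R : ℝ} (hR : 0 ≤ R) :
    TendstoUniformlyOn Ψs Ψ atTop (Metric.closedBall 0 R) := by
  have hK : IsCompact (Metric.closedBall (0 : Rd d) R) := isCompact_closedBall 0 R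
  have h0K : (0 : Rd d) ∈ Metric.closedBall (0 : Rd d) R := by simpa using hR
  have hu := (tendstoLocallyUniformlyOn_iff_tendstoUniformlyOn_of_compact hK).1
    (h.tendstoLocallyUniformlyOn (s := Metric.closedBall (0 : Rd d) R))
  -- The modulus of exp Ψ has a positive minimum on the compact ball, so the quotients exp(Ψₙ - Ψ)
  -- tend to 1 uniformly.
  obtain ⟨z₀, -, hz₀⟩ := hK.exists_isMinOn ⟨0, h0K⟩
    (f := fun z => ‖Complex.exp (Ψ z)‖) (by fun_prop)
  set m := ‖Complex.exp (Ψ z₀)‖ with hm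
  have hm0 : 0 < m := norm_pos_iff.2 (Complex.exp_ne_zero _)
  rw [Metric.tendstoUniformlyOn_iff] at hu ⊢
  intro ε hε
  -- The bound 1/2 keeps log(1+w) under control, with |log(1+w)| ≤ 3|w|/2; the bound ε/2 then gives
  -- less than ε.
  have hη : 0 < min (1 / 2) (ε / 2) := by positivity
  filter_upwards [hu (m * min (1 / 2) (ε / 2)) (by positivity)] with n hn
  have hw : ∀ z ∈ Metric.closedBall (0 : Rd d) R,
      ‖Complex.exp (Ψs n z - Ψ z) - 1‖ < min (1 / 2) (ε / 2) := by
    intro z hz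
    have h1 := hn z hz
    rw [dist_comm, dist_eq_norm] at h1
    have h2 : m ≤ ‖Complex.exp (Ψ z)‖ := hz₀ hz
    have h3 : Complex.exp (Ψs n z) - Complex.exp (Ψ z) =
        Complex.exp (Ψ z) * (Complex.exp (Ψs n z - Ψ z) - 1) := by
      rw [mul_sub, ← Complex.exp_add]; simp
    rw [h3, norm_mul] at h1
    have h4 : m * ‖Complex.exp (Ψs n z - Ψ z) - 1‖ ≤
      ‖Complex.exp (Ψ z)‖ * ‖Complex.exp (Ψs n z - Ψ z) - 1‖ := by gcongr
    exact lt_of_mul_lt_mul_left (h4.trans_lt h1) hm0.le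
  -- Both sides are continuous logarithms of the same function on a connected ball and vanish at 0,
  -- so the difference of exponents is the principal logarithm.
  have hlog : Set.EqOn (fun z => Ψs n z - Ψ z)
      (fun z => Complex.log (1 + (Complex.exp (Ψs n z - Ψ z) - 1))) (Metric.closedBall 0 R) := by
    have := hΨs n
    refine eqOn_of_exp_eq (convex_closedBall _ _).isPreconnected (by fun_prop) ?_ ?_ h0K ?_
    · refine ContinuousOn.clog (by fun_prop) fun z hz => ?_
      exact Complex.mem_slitPlane_of_norm_lt_one
        ((hw z hz).trans_le ((min_le_left _ _).trans (by norm_num)))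
    · intro z hz
      rw [Complex.exp_log] <;> simp [Complex.exp_ne_zero]
    · simp [hs0, h0]
  intro z hz
  have hz' : Ψs n z - Ψ z = _ := hlog hz
  rw [dist_comm, dist_eq_norm, hz']
  have h5 := hw z hz
  have := Complex.norm_log_one_add_half_le_self (z := Complex.exp (Ψs n z - Ψ z) - 1)
    (h5.le.trans (min_le_left _ _))
  linarith [min_le_right (1 / 2) (ε / 2)]

lemma tendsto_integral_secondDiff {Ψs : ℕ → Rd d → ℂ} {Ψ : Rd d → ℂ}
    (hΨs : ∀ n, Continuous (Ψs n)) (hΨ : Continuous Ψ)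
    (h : ∀ R, 0 ≤ R → TendstoUniformlyOn Ψs Ψ atTop (Metric.closedBall 0 R)) (j : Fin d)
    (z : Rd d) :
    Tendsto (fun n => ∫ t in (0 : ℝ)..1, secondDiff (Ψs n) j z t) atTop
      (𝓝 (∫ t in (0 : ℝ)..1, secondDiff Ψ j z t)) := by
  set K : Set (Rd d) := Metric.closedBall 0 (‖z‖ + 1)
  obtain ⟨C, hC⟩ := (isCompact_closedBall (0 : Rd d) (‖z‖ + 1)).exists_bound_of_continuousOn
    hΨ.continuousOn
  have hu := h (‖z‖ + 1) (by positivity)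
  have hmem : ∀ t ∈ Set.uIoc (0 : ℝ) 1, z ∈ K ∧ z + t • EuclideanSpace.single j 1 ∈ K ∧
      z - t • EuclideanSpace.single j 1 ∈ K := by
    intro t ht
    rw [Set.uIoc_of_le zero_le_one] at ht
    have hn : ‖t • EuclideanSpace.single j (1 : ℝ)‖ ≤ 1 := by
      rw [norm_smul, PiLp.norm_single]
      simp [abs_of_pos ht.1, ht.2]
    simp only [K, mem_closedBall_zero_iff]
    exact ⟨by linarith, (norm_add_le _ _).trans (by linarith),
      (norm_sub_le _ _).trans (by linarith)⟩
  refine intervalIntegral.tendsto_integral_filter_of_dominated_convergence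
    (fun _ => 2 * (C + 1)) ?_ ?_ (by simp) ?_
  · refine .of_forall fun n => Continuous.aestronglyMeasurable ?_
    have := hΨs n
    unfold secondDiff
    fun_prop
  · filter_upwards [Metric.tendstoUniformlyOn_iff.1 hu 1 one_pos] with n hn
    refine ae_of_all _ fun t ht => ?_
    have hb : ∀ y ∈ K, ‖Ψs n y‖ ≤ C + 1 := fun y hy => by
      have h1 := hn y hy
      have h2 := hC y hy
      rw [dist_comm, dist_eq_norm] at h1
      linarith [norm_le_norm_add_norm_sub' (Ψs n y) (Ψ y)]
    obtain ⟨h1, h2, h3⟩ := hmem t ht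
    refine (norm_sub_le _ _).trans ?_
    rw [norm_div]
    have := norm_add_le (Ψs n (z + t • EuclideanSpace.single j 1))
      (Ψs n (z - t • EuclideanSpace.single j 1))
    have := hb _ h1
    have := hb _ h2
    have := hb _ h3
    norm_num
    linarith
  · refine ae_of_all _ fun t ht => ?_
    obtain ⟨h1, h2, h3⟩ := hmem t ht
    exact (hu.tendsto_at h1).sub (((hu.tendsto_at h2).add (hu.tendsto_at h3)).div_const 2)

/-! ### Convergence of finite measures with a harmless discontinuity at 0 -/

lemma charFun_normalize (M : FiniteMeasure (Rd d)) (hM : M ≠ 0) (z : Rd d) :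
    charFun (M.normalize : Measure (Rd d)) z =
      charFun (M : Measure (Rd d)) z / charFun (M : Measure (Rd d)) 0 := by
  rw [M.toMeasure_normalize_eq_of_nonzero hM, charFun_zero, charFun_apply, charFun_apply]
  have hm : (M : Measure (Rd d)).real Set.univ = M.mass := rfl
  rw [integral_smul_nnreal_measure, hm, NNReal.smul_def, Complex.real_smul, NNReal.coe_inv,
    Complex.ofReal_inv, div_eq_inv_mul]

/-- Lévy's convergence theorem for finite measures. -/
lemma finiteMeasure_tendsto_of_charFun {Ms : ℕ → FiniteMeasure (Rd d)} {M : FiniteMeasure (Rd d)}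
    (h : ∀ z, Tendsto (fun n => charFun (Ms n : Measure (Rd d)) z) atTop
      (𝓝 (charFun (M : Measure (Rd d)) z))) : Tendsto Ms atTop (𝓝 M) := by
  have hmass : Tendsto (fun n => (Ms n).mass) atTop (𝓝 M.mass) := by
    have := h 0
    simp only [charFun_zero] at this
    have h1 := (Complex.continuous_re.tendsto _).comp this
    rw [← NNReal.tendsto_coe]
    exact h1
  -- The zero measure has no normalization; there convergence of the masses suffices.
  by_cases hM : M = 0
  · subst hM
    exact FiniteMeasure.tendsto_zero_of_tendsto_zero_mass (by simpa using hmass)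
  · have hmass0 : M.mass ≠ 0 := (M.mass_nonzero_iff).2 hM
    refine FiniteMeasure.tendsto_of_tendsto_normalize_testAgainstNN_of_tendsto_mass ?_ hmass
    refine ProbabilityMeasure.tendsto_of_tendsto_charFun fun z => ?_
    rw [charFun_normalize M hM]
    have hne : ∀ᶠ n in atTop, Ms n ≠ 0 := by
      filter_upwards [hmass.eventually_ne hmass0] with n hn
      exact (Ms n).mass_nonzero_iff.1 hn
    refine Tendsto.congr' ?_ ((h z).div (h 0) ?_)
    · filter_upwards [hne] with n hn
      rw [charFun_normalize _ hn]; rfl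
    · have hm : (M : Measure (Rd d)).real Set.univ = M.mass := rfl
      rw [charFun_zero, hm]
      exact_mod_cast hmass0

/-- The only possible discontinuity is a null point of the limit. Multiplying by χₖ = min(1,
(k+1)|x|) restores continuity, and the error is at most C∫(1-χₖ), which is small for the limit with
`k` large and hence for all large `n`. -/
lemma tendsto_integral_of_continuousOn_compl_zero {Ms : ℕ → FiniteMeasure (Rd d)}
    {M : FiniteMeasure (Rd d)} (h : Tendsto Ms atTop (𝓝 M)) (hM : (M : Measure (Rd d)) {0} = 0)
    {f : Rd d → ℂ} (hfm : Measurable f) (hf : ContinuousOn f {0}ᶜ) {C : ℝ}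
    (hC : ∀ x, ‖f x‖ ≤ C) :
    Tendsto (fun n => ∫ x, f x ∂(Ms n : Measure (Rd d))) atTop
      (𝓝 (∫ x, f x ∂(M : Measure (Rd d)))) := by
  have hC0 : 0 ≤ C := (norm_nonneg _).trans (hC 0)
  let χ : ℕ → Rd d → ℝ := fun k x => min 1 ((k + 1) * ‖x‖)
  have hχc : ∀ k, Continuous (χ k) := fun k => by simp only [χ]; fun_prop
  have hχ0 : ∀ k x, 0 ≤ χ k x := fun k x => by simp only [χ]; positivity
  have hχ1 : ∀ k x, χ k x ≤ 1 := fun k x => min_le_left _ _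
  have hχn : ∀ k x, ‖1 - χ k x‖ ≤ 1 := fun k x => by
    rw [Real.norm_of_nonneg (by linarith [hχ1 k x])]; linarith [hχ0 k x]
  have hgb : ∀ k x, ‖χ k x • f x‖ ≤ C := fun k x => by
    rw [norm_smul, Real.norm_of_nonneg (hχ0 k x)]
    nlinarith [hχ1 k x, hχ0 k x, hC x, norm_nonneg (f x)]
  have hgc : ∀ k, Continuous fun x => χ k x • f x := by
    intro k
    refine continuous_iff_continuousAt.2 fun x => ?_
    rcases eq_or_ne x 0 with rfl | hx
    · have h1 : Tendsto (fun x : Rd d => (k + 1) * ‖x‖ * C) (𝓝 0) (𝓝 ((k + 1) * ‖(0 : Rd d)‖ * C)) :=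
        Continuous.tendsto (by fun_prop) _
      have h2 : χ k 0 • f 0 = 0 := by simp [χ]
      rw [ContinuousAt, h2]
      refine squeeze_zero_norm (fun x => ?_) (by simpa using h1)
      rw [norm_smul, Real.norm_of_nonneg (hχ0 k x)]
      exact mul_le_mul (min_le_right _ _) (hC x) (norm_nonneg _) (by positivity)
    · exact (hχc k).continuousAt.smul (hf.continuousAt (isOpen_compl_singleton.mem_nhds hx))
  have hsplit : ∀ (k : ℕ) (N : Measure (Rd d)) [IsFiniteMeasure N],
      ‖∫ x, f x ∂N - ∫ x, χ k x • f x ∂N‖ ≤ C * ∫ x, (1 - χ k x) ∂N := by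
    intro k N _
    rw [← integral_sub (Integrable.of_bound hfm.aestronglyMeasurable C (ae_of_all _ hC))
      (Integrable.of_bound (hgc k).aestronglyMeasurable C (ae_of_all _ (hgb k))),
      ← integral_const_mul]
    refine norm_integral_le_of_norm_le ?_ (ae_of_all _ fun x => ?_)
    · exact (Integrable.of_bound (continuous_const.sub (hχc k)).aestronglyMeasurable 1
        (ae_of_all _ (hχn k))).const_mul C
    · have : f x - χ k x • f x = (1 - χ k x) • f x := by rw [sub_smul, one_smul]
      rw [this, norm_smul, Real.norm_of_nonneg (by linarith [hχ1 k x]), mul_comm]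
      exact mul_le_mul_of_nonneg_right (hC x) (by linarith [hχ1 k x])
  have hχM : Tendsto (fun k => ∫ x, (1 - χ k x) ∂(M : Measure (Rd d))) atTop
      (𝓝 (∫ _x, (0 : ℝ) ∂(M : Measure (Rd d)))) := by
    refine tendsto_integral_of_dominated_convergence (fun _ => 1)
      (fun k => (continuous_const.sub (hχc k)).aestronglyMeasurable) (integrable_const _)
      (fun k => ae_of_all _ (hχn k)) ?_
    have hne : ∀ᵐ x ∂(M : Measure (Rd d)), x ≠ 0 := by rw [ae_iff]; simpa using hM
    filter_upwards [hne] with x hx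
    refine tendsto_const_nhds.congr' ?_
    have h1 : Tendsto (fun k : ℕ => ((k : ℝ) + 1) * ‖x‖) atTop atTop :=
      (tendsto_natCast_atTop_atTop.atTop_add tendsto_const_nhds).atTop_mul_const (norm_pos_iff.2 hx)
    filter_upwards [h1.eventually_ge_atTop 1] with k hk
    simp [χ, min_eq_left hk]
  rw [integral_zero] at hχM
  rw [Metric.tendsto_nhds]
  intro ε hε
  obtain ⟨k, hk⟩ := (hχM.eventually_lt_const (u := ε / (3 * (C + 1))) (by positivity)).exists
  have h1 := (FiniteMeasure.tendsto_iff_forall_integral_tendsto.1 h)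
    (BoundedContinuousFunction.ofNormedAddCommGroup (fun x => 1 - χ k x)
      (continuous_const.sub (hχc k)) 1 (hχn k))
  have h2 := (FiniteMeasure.tendsto_iff_forall_integral_rclike_tendsto ℂ).1 h
    (BoundedContinuousFunction.ofNormedAddCommGroup _ (hgc k) C (hgb k))
  have hC1 : ∀ a, a < ε / (3 * (C + 1)) → C * a < ε / 3 := fun a ha => by
    rw [lt_div_iff₀ (by positivity)] at ha
    rcases le_or_gt a 0 with h' | h' <;> nlinarith
  filter_upwards [h1.eventually_lt_const hk, Metric.tendsto_nhds.1 h2 (ε / 3) (by positivity)]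
    with n hn1 hn2
  have h3 := (hsplit k (Ms n)).trans_lt (hC1 _ hn1)
  have h4 := (hsplit k M).trans_lt (hC1 _ hk)
  rw [← dist_eq_norm] at h3 h4
  rw [dist_comm] at h4
  calc _ ≤ _ := dist_triangle4 _ _ _ _
    _ < ε / 3 + ε / 3 + ε / 3 := add_lt_add (add_lt_add h3 hn2) h4
    _ = ε := by ring

/-! ### Smooth truncation of the Lévy–Khintchine integrand -/

/-- The Lévy–Khintchine integrand with smooth truncation `1 / (1 + |x|²)`. -/
def smoothIntegrand (z x : Rd d) : ℂ :=
  Complex.exp (Complex.I * (inner ℝ z x : ℝ)) - 1 -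
    Complex.I * (((1 + ‖x‖ ^ 2)⁻¹ * inner ℝ z x : ℝ) : ℂ)

/-- The difference between the smooth and the sharp truncation of the identity. -/
def truncDiff (x : Rd d) : Rd d :=
  ((1 + ‖x‖ ^ 2)⁻¹ - (Metric.closedBall (0 : Rd d) 1).indicator (fun _ => (1 : ℝ)) x) • x

lemma continuous_smoothIntegrand (z : Rd d) : Continuous (smoothIntegrand z) := by
  unfold smoothIntegrand
  have : ∀ x : Rd d, 1 + ‖x‖ ^ 2 ≠ 0 := fun x => by positivity
  fun_prop (disch := assumption)

lemma norm_smoothIntegrand_le (z x : Rd d) :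
    ‖smoothIntegrand z x‖ ≤ (2 + ‖z‖ + 3 * ‖z‖ ^ 2) * sqMin x := by
  have h0 := abs_inner_le z x
  have hz := norm_nonneg z
  have hx := norm_nonneg x
  rcases le_or_gt ‖x‖ 1 with h | h
  · have h1 : smoothIntegrand z x = (Complex.exp (Complex.I * (inner ℝ z x : ℝ)) - 1 -
        Complex.I * (inner ℝ z x : ℝ)) +
        Complex.I * (((1 - (1 + ‖x‖ ^ 2)⁻¹) * inner ℝ z x : ℝ) : ℂ) := by
      rw [smoothIntegrand]; push_cast; ring
    have h2 : (inner ℝ z x : ℝ) ^ 2 ≤ (‖z‖ * ‖x‖) ^ 2 := by rw [← sq_abs]; gcongr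
    have h3 : (1 - (1 + ‖x‖ ^ 2)⁻¹) ≤ ‖x‖ ^ 2 := by
      have h6 : 1 - (1 + ‖x‖ ^ 2)⁻¹ = ‖x‖ ^ 2 / (1 + ‖x‖ ^ 2) := by field_simp; ring
      rw [h6]
      exact div_le_self (by positivity) (by nlinarith)
    have h4 : 0 ≤ (1 - (1 + ‖x‖ ^ 2)⁻¹) := sub_nonneg.2 (inv_le_one_of_one_le₀ (by nlinarith))
    rw [h1, sqMin, min_eq_left (by nlinarith)]
    refine (norm_add_le _ _).trans ((add_le_add (norm_exp_I_mul_sub_one_sub_le _) le_rfl).trans ?_)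
    rw [norm_mul, Complex.norm_I, one_mul, Complex.norm_real, Real.norm_eq_abs, abs_mul,
      abs_of_nonneg h4]
    have h5 : (1 - (1 + ‖x‖ ^ 2)⁻¹) * |inner ℝ z x| ≤ ‖x‖ ^ 2 * ‖z‖ := by
      refine mul_le_mul h3 (h0.trans ?_) (abs_nonneg _) (by positivity)
      nlinarith
    nlinarith [sq_nonneg ‖x‖]
  · rw [sqMin, min_eq_right (by nlinarith), smoothIntegrand]
    refine (norm_sub_le _ _).trans ((add_le_add (norm_exp_I_mul_sub_one_le_two _) le_rfl).trans ?_)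
    rw [norm_mul, Complex.norm_I, one_mul, Complex.norm_real, Real.norm_eq_abs, abs_mul,
      abs_of_nonneg (by positivity)]
    have h5 : (1 + ‖x‖ ^ 2)⁻¹ * |inner ℝ z x| ≤ ‖z‖ := by
      rw [inv_mul_le_iff₀ (by positivity)]
      nlinarith [mul_nonneg hz (sq_nonneg (‖x‖ - 1))]
    nlinarith [sq_nonneg ‖z‖]

lemma norm_truncDiff_le (x : Rd d) : ‖truncDiff x‖ ≤ sqMin x := by
  have hx := norm_nonneg x
  rw [truncDiff, norm_smul, Real.norm_eq_abs]
  rcases le_or_gt ‖x‖ 1 with h | h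
  · rw [Set.indicator_of_mem (by simpa using h), sqMin, min_eq_left (by nlinarith), abs_sub_comm,
      abs_of_nonneg (sub_nonneg.2 (inv_le_one_of_one_le₀ (by nlinarith)))]
    have h1 : 1 - (1 + ‖x‖ ^ 2)⁻¹ = ‖x‖ ^ 2 / (1 + ‖x‖ ^ 2) := by field_simp; ring
    rw [h1, div_mul_eq_mul_div, div_le_iff₀ (by positivity)]
    have : ‖x‖ ^ 2 * ‖x‖ ≤ ‖x‖ ^ 2 * 1 := by gcongr
    nlinarith [sq_nonneg (‖x‖ ^ 2)]
  · rw [Set.indicator_of_notMem (by simpa using h), sqMin, min_eq_right (by nlinarith), sub_zero,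
      abs_of_nonneg (by positivity), inv_mul_le_iff₀ (by positivity)]
    nlinarith

lemma measurable_truncDiff : Measurable (truncDiff : Rd d → Rd d) := by
  have h : Measurable ((Metric.closedBall (0 : Rd d) 1).indicator fun _ => (1 : ℝ)) :=
    measurable_const.indicator measurableSet_closedBall
  unfold truncDiff
  fun_prop

/-- The location parameter with respect to the smooth truncation. -/
def smoothLocation (ν : Measure (Rd d)) (γ : Rd d) : Rd d := γ + ∫ x, truncDiff x ∂ν

namespace IsLevyMeasure

variable {ν : Measure (Rd d)}

lemma integrable_truncDiff (hν : IsLevyMeasure ν) : Integrable truncDiff ν :=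
  hν.integrable_sqMin.mono' measurable_truncDiff.aestronglyMeasurable (ae_of_all _ norm_truncDiff_le)

lemma integrable_smoothIntegrand (hν : IsLevyMeasure ν) (z : Rd d) :
    Integrable (smoothIntegrand z) ν :=
  (hν.integrable_sqMin.const_mul _).mono' (continuous_smoothIntegrand z).aestronglyMeasurable
    (ae_of_all _ (norm_smoothIntegrand_le z))

/-- The sharp cut-off jumps at |x| = 1, a sphere ν may charge, so it does not behave well in limits.
The smooth cut-off is continuous, at the price of a shifted location. -/
lemma levyExponent_eq_smooth (hν : IsLevyMeasure ν) (γ z : Rd d) :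
    levyExponent 0 ν γ z =
      ∫ x, smoothIntegrand z x ∂ν + Complex.I * (inner ℝ (smoothLocation ν γ) z : ℝ) := by
  have h1 : ∀ x, levyIntegrand z x =
      smoothIntegrand z x + Complex.I * ((inner ℝ z (truncDiff x) : ℝ) : ℂ) := by
    intro x
    rw [levyIntegrand, smoothIntegrand, truncDiff, real_inner_smul_right]
    by_cases hx : x ∈ Metric.closedBall (0 : Rd d) 1
    · simp only [hx, Set.indicator_of_mem]; push_cast; ring
    · simp only [hx, Set.indicator_of_notMem, not_false_eq_true]; push_cast; ring
  have h2 : Integrable (fun x => Complex.I * ((inner ℝ z (truncDiff x) : ℝ) : ℂ)) ν :=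
    (hν.integrable_truncDiff.const_inner z).ofReal.const_mul _
  simp only [levyExponent, quadForm, h1, smoothLocation]
  rw [integral_add (hν.integrable_smoothIntegrand z) h2, integral_const_mul,
    integral_complex_ofReal, integral_inner hν.integrable_truncDiff, inner_add_left,
    real_inner_comm z (∫ x, truncDiff x ∂ν)]
  simp
  ring

/-- Since |x|²ι(x) = x and 1/(1+|x|⁻²) = 1 - 1/(1+|x|²), the smooth truncation is reversed exactly
by ι. The closed ball and its image overlap in the unit sphere; the sphere term of the location
compensates for this overlap. -/
lemma smoothLocation_inv (hν : IsLevyMeasure ν) (γ : Rd d) :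
    smoothLocation (invMeasure ν) (invLocation ν γ) = -smoothLocation ν γ := by
  have h1 : ∫ x, truncDiff x ∂(invMeasure ν) = -∫ x, truncDiff x ∂ν -
      ∫ x in Metric.sphere (0 : Rd d) 1, x ∂ν := by
    have hs := (Metric.isClosed_sphere (x := (0 : Rd d)) (ε := 1)).measurableSet
    have hn : Integrable (fun x => -truncDiff x) ν := hν.integrable_truncDiff.neg
    rw [integral_invMeasure, ← integral_indicator hs, ← integral_neg, ← integral_sub hn
      ((integrable_indicator_iff hs).2 hν.integrableOn_sphere)]
    refine integral_congr_ae ?_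
    filter_upwards [hν.ae_ne_zero] with x hx
    have hx0 : 0 < ‖x‖ := norm_pos_iff.2 hx
    rw [truncDiff, norm_geomInv, geomInv, smul_smul, smul_smul]
    have h2 : ‖x‖ ^ 2 * ((1 + ‖x‖⁻¹ ^ 2)⁻¹ - (Metric.closedBall (0 : Rd d) 1).indicator
        (fun _ => (1 : ℝ)) ((‖x‖ ^ 2)⁻¹ • x)) * (‖x‖ ^ 2)⁻¹ =
        1 - (1 + ‖x‖ ^ 2)⁻¹ - {x : Rd d | 1 ≤ ‖x‖}.indicator (fun _ => (1 : ℝ)) x := by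
      have h3 : (Metric.closedBall (0 : Rd d) 1).indicator (fun _ => (1 : ℝ)) ((‖x‖ ^ 2)⁻¹ • x) =
          {x : Rd d | 1 ≤ ‖x‖}.indicator (fun _ => (1 : ℝ)) x := by
        have : (‖x‖ ^ 2)⁻¹ • x ∈ Metric.closedBall (0 : Rd d) 1 ↔ x ∈ {x : Rd d | 1 ≤ ‖x‖} := by
          change geomInv x ∈ _ ↔ 1 ≤ ‖x‖
          rw [mem_closedBall_zero_iff, norm_geomInv, inv_le_one₀ hx0]
        simp only [Set.indicator, this]
      rw [h3, mul_right_comm, mul_inv_cancel₀ (by positivity), one_mul]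
      congr 1
      field_simp
      ring
    rw [h2, truncDiff]
    rcases lt_trichotomy ‖x‖ 1 with h | h | h
    · rw [Set.indicator_of_notMem (by simpa using h), Set.indicator_of_mem (by simpa using h.le),
        Set.indicator_of_notMem (by simpa using h.ne)]
      module
    · rw [Set.indicator_of_mem (by simpa using h.ge), Set.indicator_of_mem (by simpa using h.le),
        Set.indicator_of_mem (by simpa using h)]
      module
    · rw [Set.indicator_of_mem (by simpa using h.le), Set.indicator_of_notMem (by simpa using h),
        Set.indicator_of_notMem (by simpa using h.ne')]
      module
  rw [smoothLocation, h1, invLocation, smoothLocation]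
  abel

end IsLevyMeasure

/-! ### Continuity of the inversion -/

lemma norm_inv_weight_smul_le {f : Rd d → ℂ} {C : ℝ} (hf : ∀ x, ‖f x‖ ≤ C * sqMin x) (hC : 0 ≤ C)
    (x : Rd d) : ‖(weight x)⁻¹ • f x‖ ≤ 20 * C := by
  rw [norm_smul, norm_inv, Real.norm_of_nonneg (weight_nonneg x)]
  rcases eq_or_ne x 0 with rfl | hx
  · have : weight (0 : Rd d) = 0 := by simp [weight]
    rw [this]; simpa using hC
  · rw [inv_mul_le_iff₀ (weight_pos hx)]
    have := hf x
    have : C * sqMin x ≤ C * (20 * weight x) := by gcongr; exact sqMin_le_weight x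
    linarith

/-- Dividing by the weight makes `f` bounded and continuous off 0, ready to be integrated against
the weakly convergent weighted measures. -/
lemma tendsto_integral_levyMeasure {νs : ℕ → Measure (Rd d)} {ν : Measure (Rd d)}
    (hνs : ∀ n, IsLevyMeasure (νs n)) (hν : IsLevyMeasure ν)
    (h : ∀ z, Tendsto (fun n => charFun (weighted (νs n)) z) atTop (𝓝 (charFun (weighted ν) z)))
    {f : Rd d → ℂ} (hfm : Measurable f) (hf : ContinuousOn f {0}ᶜ) {C : ℝ} (hC : 0 ≤ C)
    (hfC : ∀ x, ‖f x‖ ≤ C * sqMin x) :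
    Tendsto (fun n => ∫ x, f x ∂(νs n)) atTop (𝓝 (∫ x, f x ∂ν)) := by
  simp_rw [fun n => (hνs n).integral_eq_weighted f, hν.integral_eq_weighted f]
  let Ms : ℕ → FiniteMeasure (Rd d) := fun n => ⟨weighted (νs n), (hνs n).isFiniteMeasure_weighted⟩
  let M : FiniteMeasure (Rd d) := ⟨weighted ν, hν.isFiniteMeasure_weighted⟩
  have hM : Tendsto Ms atTop (𝓝 M) := finiteMeasure_tendsto_of_charFun h
  exact tendsto_integral_of_continuousOn_compl_zero hM hν.weighted_singleton_zero
    (continuous_weight.measurable.inv.smul hfm)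
    (ContinuousOn.smul (continuous_weight.continuousOn.inv₀ fun x hx => (weight_pos hx).ne') hf)
    (norm_inv_weight_smul_le hfC hC)

lemma continuousOn_geomInv : ContinuousOn (geomInv : Rd d → Rd d) {0}ᶜ := by
  unfold geomInv
  refine ContinuousOn.smul (ContinuousOn.inv₀ (continuous_norm.pow 2).continuousOn fun x hx => ?_) continuousOn_id
  exact pow_ne_zero 2 (norm_ne_zero_iff.2 hx)

/-- Continuity of the inversion with respect to weak convergence. -/
lemma tendsto_inversion {μs : ℕ → ProbabilityMeasure (Rd d)} {μ : ProbabilityMeasure (Rd d)}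
    {νs : ℕ → Measure (Rd d)} {ν : Measure (Rd d)} {γs : ℕ → Rd d} {γ : Rd d}
    (hs : ∀ n, HasTriplet (μs n) 0 (νs n) (γs n)) (hμ : HasTriplet μ 0 ν γ)
    (h : Tendsto μs atTop (𝓝 μ)) :
    Tendsto (fun n => inversion (μs n)) atTop (𝓝 (inversion μ)) := by
  have hνs := fun n => (hs n).isLevyMeasure
  have hν := hμ.isLevyMeasure
  have hu : ∀ R, 0 ≤ R → TendstoUniformlyOn (fun n => levyExponent 0 (νs n) (γs n))
      (levyExponent 0 ν γ) atTop (Metric.closedBall 0 R) := fun R hR => by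
    refine tendstoUniformlyOn_of_exp (fun n => (hs n).continuous_exponent) hμ.continuous_exponent
      (fun n => levyExponent_zero _ _ _) (levyExponent_zero _ _ _) ?_ hR
    have := tendstoLocallyUniformly_charFun h
    simp_rw [← fun n z => (hs n).charFun_eq_exp z, ← hμ.charFun_eq_exp]
    exact this
  -- No Gaussian constant appears on either side; with a Gaussian part in the limit, weighted mass
  -- could escape to 0.
  have hM : ∀ z, Tendsto (fun n => charFun (weighted (νs n)) z) atTop
      (𝓝 (charFun (weighted ν) z)) := by
    intro z
    have h1 := tendsto_finsetSum Finset.univ fun j _ => tendsto_integral_secondDiff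
      (fun n => (hs n).continuous_exponent) hμ.continuous_exponent hu j z
    simp_rw [fun n => sum_integral_secondDiff (hνs n), sum_integral_secondDiff hν] at h1
    simpa [quadForm] using h1
  -- The location term is the exponent minus the smooth jump integral, and both converge.
  have hloc : ∀ z, Tendsto (fun n => Complex.I * (inner ℝ (smoothLocation (νs n) (γs n)) z : ℝ))
      atTop (𝓝 (Complex.I * (inner ℝ (smoothLocation ν γ) z : ℝ))) := by
    intro z
    have h1 := (hu ‖z‖ (norm_nonneg z)).tendsto_at (x := z) (by simp)
    have h2 := tendsto_integral_levyMeasure hνs hν hM (continuous_smoothIntegrand z).measurable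
      (continuous_smoothIntegrand z).continuousOn (by positivity) (norm_smoothIntegrand_le z)
    refine ((h1.sub h2).congr fun n => ?_).trans ?_
    · rw [(hνs n).levyExponent_eq_smooth]; ring
    · rw [hν.levyExponent_eq_smooth]; ring_nf; exact le_rfl
  refine ProbabilityMeasure.tendsto_of_tendsto_charFun fun z => ?_
  simp_rw [fun n => (hs n).inversion.charFun_eq_exp z, hμ.inversion.charFun_eq_exp]
  refine (Complex.continuous_exp.tendsto _).comp ?_
  simp_rw [fun n => (isLevyMeasure_invMeasure (hνs n)).levyExponent_eq_smooth,
    (isLevyMeasure_invMeasure hν).levyExponent_eq_smooth, fun n => (hνs n).smoothLocation_inv,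
    hν.smoothLocation_inv, integral_invMeasure, inner_neg_left, Complex.ofReal_neg, mul_neg]
  -- Pulled back to νₙ, the jump integrand is |x|² times the smooth integrand at ι(x): still O(|x|²
  -- ∧ 1), but continuity is available only off 0.
  refine Tendsto.add (tendsto_integral_levyMeasure hνs hν hM ?_ ?_
    (C := 2 + ‖z‖ + 3 * ‖z‖ ^ 2) (by positivity) fun x => ?_) (hloc z).neg
  · exact (measurable_norm.pow_const 2).smul
      ((continuous_smoothIntegrand z).measurable.comp measurable_geomInv)
  · exact (continuous_norm.pow 2).continuousOn.smul
      ((continuous_smoothIntegrand z).comp_continuousOn continuousOn_geomInv)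
  · rw [norm_smul, Real.norm_of_nonneg (by positivity), ← norm_sq_mul_sqMin_geomInv x,
      mul_left_comm]
    gcongr
    exact norm_smoothIntegrand_le z _

/-! ### Finite mean and the first moment of large jumps -/

/-- The kernel `∫₀¹ (1 - cos (t u)) t⁻² dt`, comparable with `|u|` for large `|u|`. -/
def cosKernel (u : ℝ) : ℝ≥0∞ :=
  ∫⁻ t in Set.Ioc (0 : ℝ) 1, ENNReal.ofReal ((1 - Real.cos (t * u)) / t ^ 2)

lemma measurable_cosKernel : Measurable cosKernel := by
  unfold cosKernel
  refine Measurable.lintegral_prod_right'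
    (f := fun p : ℝ × ℝ => ENNReal.ofReal ((1 - Real.cos (p.2 * p.1)) / p.2 ^ 2)) ?_
  fun_prop

/-- For |u| > 1, restrict to t ≤ 1/|u|, where 1 - cos(tu) ≥ (tu)²/4: an interval of length 1/|u|
contributes at least |u|/4. -/
lemma abs_le_cosKernel (u : ℝ) : ENNReal.ofReal |u| ≤ 1 + 4 * cosKernel u := by
  rcases le_or_gt |u| 1 with h | h
  · refine le_trans ?_ le_self_add
    rw [← ENNReal.ofReal_one]
    exact ENNReal.ofReal_le_ofReal h
  · have hu : 0 < |u| := by linarith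
    have h1 : ENNReal.ofReal (|u| / 4) ≤ cosKernel u := by
      calc ENNReal.ofReal (|u| / 4)
          = ∫⁻ t in Set.Ioc (0 : ℝ) |u|⁻¹, ENNReal.ofReal (|u| ^ 2 / 4) := by
            rw [setLIntegral_const, Real.volume_Ioc, ← ENNReal.ofReal_mul (by positivity)]
            congr 1
            field_simp
            ring
        _ ≤ ∫⁻ t in Set.Ioc (0 : ℝ) |u|⁻¹, ENNReal.ofReal ((1 - Real.cos (t * u)) / t ^ 2) := by
            refine setLIntegral_mono' measurableSet_Ioc fun t ht => ENNReal.ofReal_le_ofReal ?_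
            have ht1 : |t * u| ≤ 1 := by
              rw [abs_mul, abs_of_pos ht.1]
              calc t * |u| ≤ |u|⁻¹ * |u| := by gcongr; exact ht.2
                _ = 1 := inv_mul_cancel₀ hu.ne'
            have h2 := (abs_le.1 (Real.cos_bound ht1)).2
            have h3 : |t * u| ^ 4 ≤ (t * u) ^ 2 := by
              have : |t * u| ^ 2 ≤ 1 := pow_le_one₀ (abs_nonneg _) ht1
              nlinarith [sq_abs (t * u), sq_nonneg (t * u)]
            rw [le_div_iff₀ (pow_pos ht.1 2), sq_abs]
            nlinarith [sq_nonneg (t * u)]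
        _ ≤ cosKernel u :=
            lintegral_mono_set (Set.Ioc_subset_Ioc_right (inv_le_one_of_one_le₀ h.le))
    calc ENNReal.ofReal |u| = 4 * ENNReal.ofReal (|u| / 4) := by
          rw [show (4 : ℝ≥0∞) = ENNReal.ofReal 4 by simp, ← ENNReal.ofReal_mul (by norm_num)]
          congr 1
          ring
      _ ≤ 4 * cosKernel u := by gcongr
      _ ≤ _ := le_add_self

lemma cosKernel_le_sq (u : ℝ) : cosKernel u ≤ ENNReal.ofReal (2 * u ^ 2) := by
  have : cosKernel u ≤ ∫⁻ _t in Set.Ioc (0 : ℝ) 1, ENNReal.ofReal (2 * u ^ 2) := by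
    refine setLIntegral_mono' measurableSet_Ioc fun t ht => ENNReal.ofReal_le_ofReal ?_
    rw [div_le_iff₀ (pow_pos ht.1 2)]
    nlinarith [Real.one_sub_sq_div_two_le_cos (x := t * u), sq_nonneg (t * u)]
  simpa using this

/-- Replacing min(v²,1) by 2v²/(1+v²) gives an integrand whose integral is explicit, namely
4u·arctan u. -/
lemma cosKernel_le_abs (u : ℝ) : cosKernel u ≤ ENNReal.ofReal (8 * |u|) := by
  have hpos : ∀ t : ℝ, 0 < 1 + (t * u) ^ 2 := fun t => by positivity
  have hc : Continuous fun t : ℝ => 4 * (u ^ 2 * (1 + (t * u) ^ 2)⁻¹) := by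
    have : ∀ t : ℝ, 1 + (t * u) ^ 2 ≠ 0 := fun t => (hpos t).ne'
    fun_prop (disch := assumption)
  calc cosKernel u
      ≤ ∫⁻ t in Set.Ioc (0 : ℝ) 1, ENNReal.ofReal (4 * (u ^ 2 * (1 + (t * u) ^ 2)⁻¹)) := by
        refine setLIntegral_mono' measurableSet_Ioc fun t ht => ENNReal.ofReal_le_ofReal ?_
        rw [div_le_iff₀ (pow_pos ht.1 2)]
        refine (one_sub_cos_le _).trans ?_
        have h1 : min ((t * u) ^ 2) 1 * (1 + (t * u) ^ 2) ≤ 2 * (t * u) ^ 2 := by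
          rcases le_total ((t * u) ^ 2) 1 with h | h
          · rw [min_eq_left h]; nlinarith [sq_nonneg (t * u)]
          · rw [min_eq_right h]; nlinarith
        have h2 : 4 * (u ^ 2 * (1 + (t * u) ^ 2)⁻¹) * t ^ 2 =
          2 * (2 * (t * u) ^ 2 / (1 + (t * u) ^ 2)) := by field_simp; ring
        rw [h2]
        gcongr
        rwa [le_div_iff₀ (hpos t)]
    _ = ENNReal.ofReal (∫ t in (0 : ℝ)..1, 4 * (u ^ 2 * (1 + (t * u) ^ 2)⁻¹)) := by
        rw [intervalIntegral.integral_of_le zero_le_one,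
          ofReal_integral_eq_lintegral_ofReal (hc.integrableOn_Ioc)
            (ae_of_all _ fun t => by have := hpos t; positivity)]
    _ ≤ ENNReal.ofReal (8 * |u|) := by
        refine ENNReal.ofReal_le_ofReal ?_
        rw [intervalIntegral.integral_const_mul, intervalIntegral.integral_const_mul]
        have h1 : u * ∫ t in (0 : ℝ)..1, (1 + (t * u) ^ 2)⁻¹ = Real.arctan u := by
          rw [intervalIntegral.mul_integral_comp_mul_right (f := fun s => (1 + s ^ 2)⁻¹)]
          simp
        have h2 : u * Real.arctan u ≤ |u| * 2 := by
          refine (le_abs_self _).trans ?_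
          rw [abs_mul]
          gcongr
          have := Real.arctan_lt_pi_div_two u
          have := Real.neg_pi_div_two_lt_arctan u
          have := Real.pi_lt_four
          exact abs_le.2 ⟨by linarith, by linarith⟩
        calc _ = 4 * (u * (u * ∫ t in (0 : ℝ)..1, (1 + (t * u) ^ 2)⁻¹)) := by ring
          _ ≤ _ := by rw [h1]; linarith

/-- Tonelli, stated for a general measure so that it serves both for μ and for its Lévy measure. -/
lemma lintegral_cosKernel {ν : Measure (Rd d)} [SFinite ν] (j : Fin d)
    (hi : ∀ t : ℝ, Integrable (fun x : Rd d => 1 - Real.cos (t * x j)) ν) :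
    ∫⁻ t in Set.Ioc (0 : ℝ) 1, ENNReal.ofReal ((∫ x, (1 - Real.cos (t * x j)) ∂ν) / t ^ 2) =
      ∫⁻ x, cosKernel (x j) ∂ν := by
  have h1 : ∀ t : ℝ, ENNReal.ofReal ((∫ x, (1 - Real.cos (t * x j)) ∂ν) / t ^ 2) =
      ∫⁻ x, ENNReal.ofReal ((1 - Real.cos (t * x j)) / t ^ 2) ∂ν := fun t => by
    rw [← integral_div, ofReal_integral_eq_lintegral_ofReal ((hi t).div_const _)
      (ae_of_all _ fun x => div_nonneg (by linarith [Real.cos_le_one (t * x j)]) (sq_nonneg t))]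
  simp_rw [h1, cosKernel]
  refine lintegral_lintegral_swap (Measurable.aemeasurable ?_)
  unfold Function.uncurry
  fun_prop

lemma norm_le_cosKernel (x : Rd d) :
    ENNReal.ofReal ‖x‖ ≤ d + 4 * ∑ j, cosKernel (x j) := by
  have h1 : ‖x‖ ≤ ∑ j, |x j| := by
    conv_lhs => rw [← (EuclideanSpace.basisFun (Fin d) ℝ).sum_repr x]
    refine (norm_sum_le _ _).trans (Finset.sum_le_sum fun j _ => ?_)
    rw [norm_smul]
    simp
  calc ENNReal.ofReal ‖x‖ ≤ ∑ j, ENNReal.ofReal |x j| := by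
        rw [← ENNReal.ofReal_sum_of_nonneg fun j _ => abs_nonneg _]
        exact ENNReal.ofReal_le_ofReal h1
    _ ≤ ∑ j : Fin d, (1 + 4 * cosKernel (x j)) := Finset.sum_le_sum fun j _ => abs_le_cosKernel _
    _ = _ := by rw [Finset.sum_add_distrib, Finset.mul_sum]; simp

lemma abs_coord_le (x : Rd d) (j : Fin d) : |x j| ≤ ‖x‖ :=
  abs_le_of_sq_le_sq (coord_sq_le x j) (norm_nonneg x)

lemma setLIntegral_norm_lt_top_of_cosKernel {ν : Measure (Rd d)} {s : Set (Rd d)}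
    (hs : ν s ≠ ∞) (h : ∀ j, ∫⁻ x, cosKernel (x j) ∂ν < ∞) :
    ∫⁻ x in s, ENNReal.ofReal ‖x‖ ∂ν < ∞ := by
  have hm : ∀ j : Fin d, Measurable fun x : Rd d => cosKernel (x j) := fun j =>
    measurable_cosKernel.comp (by fun_prop)
  have hms : Measurable fun x : Rd d => ∑ j, cosKernel (x j) :=
    Finset.measurable_sum _ fun j _ => hm j
  refine (lintegral_mono fun x => norm_le_cosKernel x).trans_lt ?_
  rw [lintegral_add_left measurable_const, setLIntegral_const, lintegral_const_mul _ hms,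
    lintegral_finsetSum _ fun j _ => hm j]
  refine ENNReal.add_lt_top.2 ⟨ENNReal.mul_lt_top (by simp) hs.lt_top,
    ENNReal.mul_lt_top (by simp) (ENNReal.sum_lt_top.2 fun j _ => ?_)⟩
  exact (setLIntegral_le_lintegral _ _).trans_lt (h j)

lemma hasMean_iff_lintegral (μ : ProbabilityMeasure (Rd d)) :
    HasMean μ ↔ ∫⁻ x, ENNReal.ofReal ‖x‖ ∂(μ : Measure (Rd d)) < ∞ := by
  rw [HasMean, ← integrable_norm_iff (by fun_prop), Integrable, hasFiniteIntegral_iff_ofReal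
    (ae_of_all _ fun x => norm_nonneg x)]
  exact and_iff_right (by fun_prop)

lemma hasMean_iff_cosKernel (μ : ProbabilityMeasure (Rd d)) :
    HasMean μ ↔ ∀ j, ∫⁻ x, cosKernel (x j) ∂(μ : Measure (Rd d)) < ∞ := by
  rw [hasMean_iff_lintegral]
  constructor
  · intro h j
    have h1 : ∫⁻ x, cosKernel (x j) ∂(μ : Measure (Rd d)) ≤
        ∫⁻ x, 8 * ENNReal.ofReal ‖x‖ ∂(μ : Measure (Rd d)) := by
      refine lintegral_mono fun x => (cosKernel_le_abs _).trans ?_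
      rw [ENNReal.ofReal_mul (by norm_num)]
      gcongr
      · simp
      · exact abs_coord_le x j
    rw [lintegral_const_mul _ (by fun_prop)] at h1
    exact h1.trans_lt (ENNReal.mul_lt_top (by simp) h)
  · intro h
    simpa using setLIntegral_norm_lt_top_of_cosKernel (s := Set.univ) (measure_ne_top _ _) h

/-- The first moment of the large jumps, `∫_{|x| ≥ 1} |x| ν(dx)`, is finite. -/
def HasTailMoment (ν : Measure (Rd d)) : Prop :=
  ∫⁻ x in {x : Rd d | 1 ≤ ‖x‖}, ENNReal.ofReal ‖x‖ ∂ν < ∞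

lemma measurableSet_one_le_norm : MeasurableSet {x : Rd d | 1 ≤ ‖x‖} :=
  measurableSet_le measurable_const measurable_norm

namespace IsLevyMeasure

variable {ν : Measure (Rd d)}

lemma integrable_one_sub_cos (hν : IsLevyMeasure ν) (j : Fin d) (t : ℝ) :
    Integrable (fun x : Rd d => 1 - Real.cos (t * x j)) ν := by
  refine (hν.integrable_sqMin.const_mul (2 * (1 + t ^ 2))).mono'
    (Continuous.aestronglyMeasurable (by fun_prop)) (ae_of_all _ fun x => ?_)
  rw [Real.norm_of_nonneg (by linarith [Real.cos_le_one (t * x j)])]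
  have h1 := one_sub_cos_le (t * x j)
  have h2 := min_mul_sq_le t (x j)
  have h3 : (1 + t ^ 2) * min (x j ^ 2) 1 ≤ (1 + t ^ 2) * sqMin x := by
    gcongr; exact min_coord_le x j
  linarith

/-- The kernel is O(u²), so small jumps always contribute finitely, and it grows like |u|, so large
jumps give the first moment. -/
lemma hasTailMoment_iff_cosKernel (hν : IsLevyMeasure ν) :
    HasTailMoment ν ↔ ∀ j, ∫⁻ x, cosKernel (x j) ∂ν < ∞ := by
  constructor
  · intro h j
    have h1 : ∀ x : Rd d, cosKernel (x j) ≤ 2 * ENNReal.ofReal (sqMin x) +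
        8 * {x : Rd d | 1 ≤ ‖x‖}.indicator (fun x => ENNReal.ofReal ‖x‖) x := by
      intro x
      by_cases hx : 1 ≤ ‖x‖
      · rw [Set.indicator_of_mem (show x ∈ {x : Rd d | 1 ≤ ‖x‖} from hx)]
        refine ((cosKernel_le_abs _).trans ?_).trans le_add_self
        rw [ENNReal.ofReal_mul (by norm_num)]
        gcongr
        · simp
        · exact abs_coord_le x j
      · refine ((cosKernel_le_sq _).trans ?_).trans le_self_add
        rw [ENNReal.ofReal_mul (by norm_num), sqMin, min_eq_left (by
          have := norm_nonneg x
          nlinarith)]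
        exact mul_le_mul' (by simp) (ENNReal.ofReal_le_ofReal (coord_sq_le x j))
    refine (lintegral_mono h1).trans_lt ?_
    rw [lintegral_add_left (measurable_sqMin.ennreal_ofReal.const_mul 2),
      lintegral_const_mul _ measurable_sqMin.ennreal_ofReal,
      lintegral_const_mul _ (Measurable.indicator (by fun_prop) measurableSet_one_le_norm),
      lintegral_indicator measurableSet_one_le_norm]
    exact ENNReal.add_lt_top.2 ⟨ENNReal.mul_lt_top (by simp) hν.2, ENNReal.mul_lt_top (by simp) h⟩
  · intro h
    refine setLIntegral_norm_lt_top_of_cosKernel ?_ h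
    refine ((measure_mono fun x hx => ?_).trans_lt
      (hν.measure_lt_norm_lt_top (ε := 1 / 2) (by norm_num))).ne
    have : 1 ≤ ‖x‖ := hx
    change 1 / 2 < ‖x‖
    linarith

lemma integrable_tail (h : HasTailMoment ν) :
    Integrable ({x : Rd d | 1 ≤ ‖x‖}.indicator fun x => ‖x‖) ν := by
  rw [integrable_indicator_iff measurableSet_one_le_norm]
  exact ⟨by fun_prop, (hasFiniteIntegral_iff_ofReal (ae_of_all _ fun x => norm_nonneg x)).2 h⟩

end IsLevyMeasure

lemma re_charFun_single (μ : ProbabilityMeasure (Rd d)) (j : Fin d) (t : ℝ) :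
    1 - (charFun (μ : Measure (Rd d)) (t • EuclideanSpace.single j 1)).re =
      ∫ x, (1 - Real.cos (t * x j)) ∂(μ : Measure (Rd d)) := by
  have hi : Integrable (fun x : Rd d => Complex.exp ((t * x j : ℝ) * Complex.I))
      (μ : Measure (Rd d)) :=
    Integrable.of_bound (by fun_prop) 1 (ae_of_all _ fun x => by
      rw [Complex.norm_exp_ofReal_mul_I])
  have hc : Integrable (fun x : Rd d => Real.cos (t * x j)) (μ : Measure (Rd d)) :=
    Integrable.of_bound (by fun_prop) 1 (ae_of_all _ fun x => Real.abs_cos_le_one _)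
  rw [charFun_apply]
  simp_rw [fun x => real_inner_comm (t • EuclideanSpace.single j (1 : ℝ)) x, inner_smul_single]
  rw [integral_sub (integrable_const _) hc]
  have := integral_re hi
  simp only [RCLike.re_eq_complex_re, Complex.exp_ofReal_mul_I_re] at this
  rw [← this]
  simp

lemma re_levyExponent_single {ν : Measure (Rd d)} (hν : IsLevyMeasure ν) (γ : Rd d) (j : Fin d)
    (t : ℝ) :
    (levyExponent 0 ν γ (t • EuclideanSpace.single j 1)).re =
      -∫ x, (1 - Real.cos (t * x j)) ∂ν := by
  have h1 := integral_re (integrable_levyIntegrand hν (t • EuclideanSpace.single j (1 : ℝ)))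
  have h2 : ∀ x : Rd d, (levyIntegrand (t • EuclideanSpace.single j 1) x).re =
      -(1 - Real.cos (t * x j)) := by
    intro x
    rw [levyIntegrand, inner_smul_single, mul_comm Complex.I]
    have h3 : ((Metric.closedBall (0 : Rd d) 1).indicator (fun _ => (1 : ℂ)) x).im = 0 := by
      by_cases hx : x ∈ Metric.closedBall (0 : Rd d) 1 <;> simp [hx]
    simp only [Complex.sub_re, Complex.exp_ofReal_mul_I_re, Complex.one_re, Complex.mul_re,
      Complex.ofReal_re, Complex.ofReal_im, Complex.I_re, Complex.I_im, Complex.mul_im, h3]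
    ring
  simp only [RCLike.re_eq_complex_re, h2] at h1
  rw [integral_neg] at h1
  simp only [levyExponent, quadForm]
  simp [h1]

lemma norm_levyExponent_smul_le {ν : Measure (Rd d)} (hν : IsLevyMeasure ν)
    (h : HasTailMoment ν) (γ z : Rd d) (hz : ‖z‖ = 1) {t : ℝ} (ht0 : 0 ≤ t) (ht : t ≤ 1) :
    ‖levyExponent 0 ν γ (t • z)‖ ≤
      t * (∫ x, (3 * sqMin x + {x : Rd d | 1 ≤ ‖x‖}.indicator (fun x => ‖x‖) x) ∂ν + ‖γ‖) := by
  have hi := (hν.integrable_sqMin.const_mul 3).add (IsLevyMeasure.integrable_tail h)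
  have h1 : ‖∫ x, levyIntegrand (t • z) x ∂ν‖ ≤
      ∫ x, t * (3 * sqMin x + {x : Rd d | 1 ≤ ‖x‖}.indicator (fun x => ‖x‖) x) ∂ν := by
    refine norm_integral_le_of_norm_le (hi.const_mul t) (ae_of_all _ fun x => ?_)
    have hx0 := norm_nonneg x
    have h2 : |inner ℝ (t • z) x| ≤ t * ‖x‖ := by
      refine (abs_inner_le _ _).trans_eq ?_
      rw [norm_smul, hz, Real.norm_of_nonneg ht0, mul_one]
    rcases le_or_gt ‖x‖ 1 with hx | hx
    · rw [levyIntegrand_of_le hx, sqMin, min_eq_left (by nlinarith)]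
      refine (norm_exp_I_mul_sub_one_sub_le _).trans ?_
      have h3 : (inner ℝ (t • z) x : ℝ) ^ 2 ≤ (t * ‖x‖) ^ 2 := by rw [← sq_abs]; gcongr
      have h4 : 0 ≤ {x : Rd d | 1 ≤ ‖x‖}.indicator (fun x => ‖x‖) x :=
        Set.indicator_nonneg (fun x _ => norm_nonneg x) x
      have h5 : t ^ 2 * ‖x‖ ^ 2 ≤ t * ‖x‖ ^ 2 := by
        gcongr
        nlinarith
      nlinarith [mul_nonneg ht0 h4]
    · rw [levyIntegrand_of_lt hx,
        Set.indicator_of_mem (show x ∈ {x : Rd d | 1 ≤ ‖x‖} from hx.le)]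
      refine (norm_exp_I_mul_sub_one_le _).trans (h2.trans ?_)
      have := sqMin_nonneg x
      gcongr
      linarith
  rw [integral_const_mul] at h1
  have h6 : ‖Complex.I * ((inner ℝ γ (t • z) : ℝ) : ℂ)‖ ≤ t * ‖γ‖ := by
    rw [norm_mul, Complex.norm_I, one_mul, Complex.norm_real]
    refine (abs_inner_le _ _).trans_eq ?_
    rw [norm_smul, hz, Real.norm_of_nonneg ht0]
    ring
  rw [mul_add]
  simp only [levyExponent, quadForm]
  simp only [map_zero, LinearMap.zero_apply, inner_zero_right, Complex.ofReal_zero, mul_zero,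
    zero_add]
  exact (norm_add_le _ _).trans (add_le_add h1 h6)

namespace HasTriplet

variable {μ : ProbabilityMeasure (Rd d)} {ν : Measure (Rd d)} {γ : Rd d}

/-- Write μ̂(teⱼ) = exp(-r + ia), so that 1 - Re μ̂ = 1 - e⁻ʳ cos a. As r ≤ B on (0,1], r ≤ e^B(1 -
e⁻ʳ cos a). Conversely the tail moment gives |a| ≤ Ct, so 1 - e⁻ʳ cos a ≤ r + C²t²/2, and the error
stays bounded after division by t². -/
lemma hasMean_iff (hμ : HasTriplet μ 0 ν γ) : HasMean μ ↔ HasTailMoment ν := by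
  have hν := hμ.isLevyMeasure
  have := hν.sigmaFinite
  have hR0 (j : Fin d) (t : ℝ) : 0 ≤ ∫ x, (1 - Real.cos (t * x j)) ∂ν :=
    integral_nonneg fun x => by simpa using Real.cos_le_one (t * x j)
  have hre (j : Fin d) (t : ℝ) : (charFun (μ : Measure (Rd d))
      (t • EuclideanSpace.single j 1)).re = Real.exp (-∫ x, (1 - Real.cos (t * x j)) ∂ν) *
        Real.cos (levyExponent 0 ν γ (t • EuclideanSpace.single j 1)).im := by
    rw [hμ.charFun_eq_exp, Complex.exp_re, re_levyExponent_single hν]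
  have hμi (j : Fin d) (t : ℝ) : Integrable (fun x : Rd d => 1 - Real.cos (t * x j))
      (μ : Measure (Rd d)) :=
    (integrable_const _).sub (Integrable.of_bound (by fun_prop) 1
      (ae_of_all _ fun x => Real.abs_cos_le_one _))
  rw [hasMean_iff_cosKernel]
  simp_rw [← fun j => lintegral_cosKernel (ν := (μ : Measure (Rd d))) j (hμi j),
    ← re_charFun_single, hre]
  constructor
  · intro h
    rw [hν.hasTailMoment_iff_cosKernel]
    intro j
    rw [← lintegral_cosKernel j (hν.integrable_one_sub_cos j)]
    set B : ℝ := 4 * ∫ x, sqMin x ∂ν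
    have hB : ∀ t ∈ Set.Ioc (0 : ℝ) 1, ∫ x, (1 - Real.cos (t * x j)) ∂ν ≤ B := by
      intro t ht
      refine (integral_mono (hν.integrable_one_sub_cos j t) (hν.integrable_sqMin.const_mul 4)
        fun x => ?_).trans_eq (integral_const_mul _ _)
      have h1 := one_sub_cos_le (t * x j)
      have h2 : min ((t * x j) ^ 2) 1 ≤ min (x j ^ 2) 1 := by
        refine min_le_min ?_ le_rfl
        rw [mul_pow]
        exact mul_le_of_le_one_left (sq_nonneg _) (pow_le_one₀ ht.1.le ht.2)
      have h3 := min_coord_le x j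
      have h4 := sqMin_nonneg x
      simp only
      linarith
    have h1 : ∫⁻ t in Set.Ioc (0 : ℝ) 1,
        ENNReal.ofReal ((∫ x, (1 - Real.cos (t * x j)) ∂ν) / t ^ 2) ≤
        ∫⁻ t in Set.Ioc (0 : ℝ) 1, ENNReal.ofReal (Real.exp B) *
          ENNReal.ofReal ((1 - Real.exp (-∫ x, (1 - Real.cos (t * x j)) ∂ν) *
            Real.cos (levyExponent 0 ν γ (t • EuclideanSpace.single j 1)).im) / t ^ 2) := by
      refine setLIntegral_mono' measurableSet_Ioc fun t ht => ?_
      rw [← ENNReal.ofReal_mul (Real.exp_pos _).le, ← mul_div_assoc]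
      refine ENNReal.ofReal_le_ofReal ?_
      gcongr
      have h2 := hB t ht
      have h3 := hR0 j t
      set r := ∫ x, (1 - Real.cos (t * x j)) ∂ν
      have h4 := Real.add_one_le_exp r
      have h5 : Real.exp (-r) * Real.exp r = 1 := by rw [← Real.exp_add]; simp
      have h6 := Real.exp_pos (-r)
      have h7 : Real.exp (-r) * Real.cos
          (levyExponent 0 ν γ (t • EuclideanSpace.single j 1)).im ≤ Real.exp (-r) :=
        mul_le_of_le_one_right h6.le (Real.cos_le_one _)
      have h8 : Real.exp r ≤ Real.exp B := Real.exp_le_exp.2 h2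
      have h9 : 0 ≤ 1 - Real.exp (-r) := by
        rw [sub_nonneg, Real.exp_le_one_iff]; linarith
      calc r ≤ Real.exp r - 1 := by linarith
        _ = Real.exp r * (1 - Real.exp (-r)) := by linear_combination h5
        _ ≤ Real.exp B * (1 - Real.exp (-r)) := by gcongr
        _ ≤ _ := by gcongr
    rw [lintegral_const_mul' _ _ ENNReal.ofReal_ne_top] at h1
    exact h1.trans_lt (ENNReal.mul_lt_top ENNReal.ofReal_lt_top (h j))
  · intro h j
    have hK := hν.hasTailMoment_iff_cosKernel.1 h j
    rw [← lintegral_cosKernel j (hν.integrable_one_sub_cos j)] at hK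
    set C := ∫ x, (3 * sqMin x + {x : Rd d | 1 ≤ ‖x‖}.indicator (fun x => ‖x‖) x) ∂ν + ‖γ‖
    have h1 : ∀ t ∈ Set.Ioc (0 : ℝ) 1, ENNReal.ofReal
        ((1 - Real.exp (-∫ x, (1 - Real.cos (t * x j)) ∂ν) *
            Real.cos (levyExponent 0 ν γ (t • EuclideanSpace.single j 1)).im) / t ^ 2) ≤
        ENNReal.ofReal ((∫ x, (1 - Real.cos (t * x j)) ∂ν) / t ^ 2) + ENNReal.ofReal (C ^ 2 / 2) := by
      intro t ht
      have h3 := hR0 j t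
      rw [← ENNReal.ofReal_add (by positivity) (by positivity)]
      refine ENNReal.ofReal_le_ofReal ?_
      have h2 : |(levyExponent 0 ν γ (t • EuclideanSpace.single j 1)).im| ≤ t * C :=
        (Complex.abs_im_le_norm _).trans (norm_levyExponent_smul_le hν h γ _ (by simp) ht.1.le ht.2)
      set r := ∫ x, (1 - Real.cos (t * x j)) ∂ν
      set a := (levyExponent 0 ν γ (t • EuclideanSpace.single j 1)).im
      have ht2 : 0 < t ^ 2 := pow_pos ht.1 2
      have h4 : a ^ 2 ≤ (t * C) ^ 2 := by rw [← sq_abs]; gcongr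
      rw [div_add' _ _ _ ht2.ne']
      gcongr
      have h5 := Real.one_sub_sq_div_two_le_cos (x := a)
      have h6 := Real.add_one_le_exp (-r)
      have h7 := Real.exp_pos (-r)
      have h8 : Real.exp (-r) ≤ 1 := Real.exp_le_one_iff.2 (by linarith)
      have h9 : Real.exp (-r) * (1 - Real.cos a) ≤ 1 * (1 - Real.cos a) := by
        gcongr
        linarith [Real.cos_le_one a]
      nlinarith
    refine (setLIntegral_mono' measurableSet_Ioc h1).trans_lt ?_
    rw [lintegral_add_right _ measurable_const]
    exact ENNReal.add_lt_top.2 ⟨hK, by simp⟩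

end HasTriplet

/-! ### The mean in terms of the triplet, and the drift of the inversion -/

lemma measurableSet_one_lt_norm : MeasurableSet {x : Rd d | 1 < ‖x‖} :=
  measurableSet_lt measurable_const measurable_norm

lemma integrableOn_tail {ν : Measure (Rd d)} (h : HasTailMoment ν) :
    IntegrableOn (fun x : Rd d => x) {x : Rd d | 1 ≤ ‖x‖} ν := by
  rw [IntegrableOn, ← integrable_norm_iff (by fun_prop)]
  exact (integrable_indicator_iff measurableSet_one_le_norm).1 (IsLevyMeasure.integrable_tail h)

lemma hasDerivAt_exp_smul (z x : Rd d) (t : ℝ) :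
    HasDerivAt (fun t : ℝ => Complex.exp (Complex.I * (inner ℝ (t • z) x : ℝ)))
      (Complex.I * (inner ℝ z x : ℝ) * Complex.exp (Complex.I * (inner ℝ (t • z) x : ℝ))) t := by
  simp_rw [real_inner_smul_left]
  have h1 : HasDerivAt (fun t : ℝ => Complex.I * ((t * inner ℝ z x : ℝ) : ℂ))
      (Complex.I * ((1 * inner ℝ z x : ℝ) : ℂ)) t :=
    (((hasDerivAt_id t).mul_const _).ofReal_comp).const_mul _
  convert h1.cexp using 1
  rw [one_mul, mul_comm]

lemma hasDerivAt_charFun_smul {μ : ProbabilityMeasure (Rd d)} (hμ : HasMean μ) (z : Rd d) :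
    HasDerivAt (fun t : ℝ => charFun (μ : Measure (Rd d)) (t • z))
      (Complex.I * (inner ℝ z (mean μ) : ℝ)) 0 := by
  have hn : Integrable (fun x : Rd d => ‖z‖ * ‖x‖) (μ : Measure (Rd d)) := hμ.norm.const_mul _
  have h := (hasDerivAt_integral_of_dominated_loc_of_deriv_le (μ := (μ : Measure (Rd d)))
    (F := fun t x => Complex.exp (Complex.I * (inner ℝ (t • z) x : ℝ)))
    (F' := fun t x => Complex.I * (inner ℝ z x : ℝ) *
      Complex.exp (Complex.I * (inner ℝ (t • z) x : ℝ))) (x₀ := 0) (s := Set.univ)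
    (bound := fun x => ‖z‖ * ‖x‖) univ_mem
    (.of_forall fun t => Continuous.aestronglyMeasurable (by fun_prop))
    (by simp) (Continuous.aestronglyMeasurable (by fun_prop))
    (ae_of_all _ fun x t _ => by
      rw [norm_mul, Complex.norm_exp_I_mul_ofReal, mul_one, norm_mul, Complex.norm_I, one_mul,
        Complex.norm_real]
      exact abs_inner_le z x) hn
    (ae_of_all _ fun x t _ => hasDerivAt_exp_smul z x t)).2
  have h2 : (∫ x, Complex.I * (inner ℝ z x : ℝ) *
      Complex.exp (Complex.I * (inner ℝ ((0 : ℝ) • z) x : ℝ)) ∂(μ : Measure (Rd d))) =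
      Complex.I * (inner ℝ z (mean μ) : ℝ) := by
    simp only [zero_smul, inner_zero_left, Complex.ofReal_zero, mul_zero, Complex.exp_zero, mul_one]
    rw [integral_const_mul, integral_complex_ofReal, integral_inner hμ]
    rfl
  rw [h2] at h
  refine h.congr_of_eventuallyEq (.of_forall fun t => ?_)
  simp only [charFun_apply]
  simp_rw [real_inner_comm (t • z), mul_comm Complex.I]

/-- At t = 0 the differentiated exponential and the compensator cancel on the closed unit ball,
leaving the jumps with |x| > 1. The derivative is dominated by O(|x|²) for small jumps and O(|x|)
for large ones. -/
lemma hasDerivAt_levyExponent_smul {ν : Measure (Rd d)} (hν : IsLevyMeasure ν)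
    (h : HasTailMoment ν) (γ z : Rd d) :
    HasDerivAt (fun t : ℝ => levyExponent 0 ν γ (t • z))
      (Complex.I * (inner ℝ z (γ + ∫ x in {x : Rd d | 1 < ‖x‖}, x ∂ν) : ℝ)) 0 := by
  have hit : IntegrableOn (fun x : Rd d => x) {x : Rd d | 1 < ‖x‖} ν :=
    (integrableOn_tail h).mono_set fun x (hx : 1 < ‖x‖) => hx.le
  have hbi : Integrable (fun x => ‖z‖ ^ 2 * sqMin x +
      ‖z‖ * {x : Rd d | 1 ≤ ‖x‖}.indicator (fun x => ‖x‖) x) ν :=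
    (hν.integrable_sqMin.const_mul _).add ((IsLevyMeasure.integrable_tail h).const_mul _)
  let χ : Rd d → ℂ := (Metric.closedBall (0 : Rd d) 1).indicator fun _ => 1
  have hχ : Measurable χ := measurable_const.indicator measurableSet_closedBall
  have h1 := (hasDerivAt_integral_of_dominated_loc_of_deriv_le (μ := ν)
    (F := fun t x => levyIntegrand (t • z) x)
    (F' := fun t x => Complex.I * (inner ℝ z x : ℝ) *
      (Complex.exp (Complex.I * (inner ℝ (t • z) x : ℝ)) - χ x)) (x₀ := (0 : ℝ))
    (s := Metric.ball 0 1)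
    (bound := fun x => ‖z‖ ^ 2 * sqMin x + ‖z‖ * {x : Rd d | 1 ≤ ‖x‖}.indicator (fun x => ‖x‖) x)
    (Metric.ball_mem_nhds _ one_pos)
    (.of_forall fun t => (measurable_levyIntegrand _).aestronglyMeasurable)
    (integrable_levyIntegrand hν _) (Measurable.aestronglyMeasurable (by fun_prop))
    (ae_of_all _ fun x t ht => by
      have ht1 : |t| ≤ 1 := by
        rw [mem_ball_zero_iff] at ht
        exact ht.le
      have hx0 := norm_nonneg x
      have hz0 := norm_nonneg z
      have h3 := abs_inner_le z x
      rw [norm_mul, norm_mul, Complex.norm_I, one_mul, Complex.norm_real, Real.norm_eq_abs]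
      rcases le_or_gt ‖x‖ 1 with hx | hx
      · have h2 : χ x = 1 := Set.indicator_of_mem (by simpa using hx) _
        have h4 : 0 ≤ {x : Rd d | 1 ≤ ‖x‖}.indicator (fun x => ‖x‖) x :=
          Set.indicator_nonneg (fun x _ => norm_nonneg x) x
        have h5 : |inner ℝ (t • z) x| ≤ ‖z‖ * ‖x‖ := by
          rw [real_inner_smul_left, abs_mul]
          calc |t| * |inner ℝ z x| ≤ 1 * (‖z‖ * ‖x‖) := by gcongr
            _ = _ := one_mul _
        rw [h2, sqMin, min_eq_left (by nlinarith)]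
        calc _ ≤ (‖z‖ * ‖x‖) * (‖z‖ * ‖x‖) :=
              mul_le_mul h3 ((norm_exp_I_mul_sub_one_le _).trans h5) (norm_nonneg _) (by positivity)
          _ ≤ _ := by nlinarith [mul_nonneg hz0 h4]
      · have h2 : χ x = 0 := Set.indicator_of_notMem (by simpa using hx) _
        have := sqMin_nonneg x
        rw [h2, sub_zero, Complex.norm_exp_I_mul_ofReal, mul_one,
          Set.indicator_of_mem (show x ∈ {x : Rd d | 1 ≤ ‖x‖} from hx.le)]
        nlinarith [mul_nonneg (sq_nonneg ‖z‖) this]) hbi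
    (ae_of_all _ fun x t _ => by
      have h3 : HasDerivAt (fun t : ℝ => Complex.I * ((t * inner ℝ z x : ℝ) : ℂ) * χ x)
          (Complex.I * ((1 * inner ℝ z x : ℝ) : ℂ) * χ x) t :=
        ((((hasDerivAt_id t).mul_const _).ofReal_comp).const_mul _).mul_const _
      convert ((hasDerivAt_exp_smul z x t).sub_const 1).sub h3 using 1
      · ext t
        simp only [levyIntegrand, Pi.sub_apply, real_inner_smul_left, χ]
      · rw [one_mul]; ring)).2
  have h2 : (∫ x, Complex.I * (inner ℝ z x : ℝ) *
      (Complex.exp (Complex.I * (inner ℝ ((0 : ℝ) • z) x : ℝ)) - χ x) ∂ν) =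
      Complex.I * (inner ℝ z (∫ x in {x : Rd d | 1 < ‖x‖}, x ∂ν) : ℝ) := by
    rw [← integral_inner hit, ← integral_complex_ofReal, ← integral_const_mul,
      ← integral_indicator measurableSet_one_lt_norm]
    refine integral_congr_ae (ae_of_all _ fun x => ?_)
    rcases le_or_gt ‖x‖ 1 with hx | hx
    · simp [χ, hx, hx.not_gt]
    · simp [χ, hx]
  rw [h2] at h1
  have h3 : HasDerivAt (fun t : ℝ => Complex.I * ((t * inner ℝ γ z : ℝ) : ℂ))
      (Complex.I * ((1 * inner ℝ γ z : ℝ) : ℂ)) 0 :=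
    (((hasDerivAt_id (0 : ℝ)).mul_const _).ofReal_comp).const_mul _
  have he : ∀ t : ℝ, levyExponent 0 ν γ (t • z) =
      ∫ x, levyIntegrand (t • z) x ∂ν + Complex.I * ((t * inner ℝ γ z : ℝ) : ℂ) := fun t => by
    simp [levyExponent, quadForm, real_inner_smul_right]
  refine ((h1.add h3).congr_deriv ?_).congr_of_eventuallyEq (.of_forall he)
  rw [inner_add_right, one_mul, real_inner_comm z γ]
  push_cast
  ring

lemma HasTriplet.mean_eq {μ : ProbabilityMeasure (Rd d)} {ν : Measure (Rd d)} {γ : Rd d}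
    (hμ : HasTriplet μ 0 ν γ) (hm : HasMean μ) :
    mean μ = γ + ∫ x in {x : Rd d | 1 < ‖x‖}, x ∂ν := by
  refine ext_inner_left ℝ fun z => ?_
  have h1 := hasDerivAt_charFun_smul hm z
  have h2 := (hasDerivAt_levyExponent_smul hμ.isLevyMeasure (hμ.hasMean_iff.1 hm) γ z).cexp
  simp_rw [hμ.charFun_eq_exp] at h1
  have h3 := h1.unique h2
  rw [zero_smul, levyExponent_zero, Complex.exp_zero, one_mul] at h3
  exact_mod_cast mul_left_cancel₀ Complex.I_ne_zero h3

lemma HasTriplet.hasDrift_inversion_iff {μ : ProbabilityMeasure (Rd d)} {ν : Measure (Rd d)}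
    {γ : Rd d} (hμ : HasTriplet μ 0 ν γ) : HasDrift (LevyInversion.inversion μ) ↔ HasMean μ := by
  have h := hμ.lintegral_rpow_inversion 1
  have hs : {x : Rd d | ‖x‖ ≤ 1} = Metric.closedBall (0 : Rd d) 1 := by ext; simp
  rw [hs, hμ.levyMeasure_eq] at h
  simp only [show (2 - 1 : ℝ) = 1 by norm_num, Real.rpow_one] at h
  rw [hμ.hasMean_iff, HasDrift, h, HasTailMoment]

lemma levyExponent_eq_drift {ν : Measure (Rd d)} (hν : IsLevyMeasure ν)
    (h : ∫⁻ x in Metric.closedBall (0 : Rd d) 1, ENNReal.ofReal ‖x‖ ∂ν < ∞) (γ z : Rd d) :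
    levyExponent 0 ν γ z = ∫ x, (Complex.exp (Complex.I * (inner ℝ z x : ℝ)) - 1) ∂ν +
      Complex.I * (inner ℝ (γ - ∫ x in Metric.closedBall (0 : Rd d) 1, x ∂ν) z : ℝ) := by
  have hi : IntegrableOn (fun x : Rd d => x) (Metric.closedBall 0 1) ν := by
    rw [IntegrableOn, ← integrable_norm_iff (by fun_prop)]
    exact ⟨by fun_prop, (hasFiniteIntegral_iff_ofReal (ae_of_all _ fun x => norm_nonneg x)).2 h⟩
  have h3 : Integrable ((Metric.closedBall (0 : Rd d) 1).indicator
      fun x => Complex.I * (inner ℝ z x : ℝ)) ν := by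
    rw [integrable_indicator_iff measurableSet_closedBall]
    exact ((hi.const_inner z).ofReal).const_mul _
  have h4 : ∀ x, Complex.exp (Complex.I * (inner ℝ z x : ℝ)) - 1 = levyIntegrand z x +
      (Metric.closedBall (0 : Rd d) 1).indicator (fun x => Complex.I * (inner ℝ z x : ℝ)) x := by
    intro x
    by_cases hx : x ∈ Metric.closedBall (0 : Rd d) 1 <;> simp [levyIntegrand, hx]
  simp_rw [h4]
  rw [integral_add (integrable_levyIntegrand hν z) h3,
    integral_indicator measurableSet_closedBall, integral_const_mul, integral_complex_ofReal,
    integral_inner hi, inner_sub_left, real_inner_comm z (∫ x in _, x ∂ν)]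
  simp [levyExponent, quadForm]
  ring

/-- The defining formula fixes only exp(i⟨c,z⟩) for all z; uniqueness of continuous logarithms
recovers c. -/
lemma HasTriplet.isDrift_iff {μ : ProbabilityMeasure (Rd d)} {ν : Measure (Rd d)} {γ : Rd d}
    (hμ : HasTriplet μ 0 ν γ) (h : HasDrift μ) (c : Rd d) :
    IsDrift μ c ↔ c = γ - ∫ x in Metric.closedBall (0 : Rd d) 1, x ∂ν := by
  have hd := h
  rw [HasDrift, hμ.levyMeasure_eq] at hd
  rw [IsDrift, and_iff_right h, hμ.levyMeasure_eq, hμ.gaussCov_eq]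
  simp_rw [hμ.charFun_eq_exp, levyExponent_eq_drift hμ.isLevyMeasure hd γ]
  simp only [quadForm, map_zero, LinearMap.zero_apply, inner_zero_right, Complex.ofReal_zero,
    mul_zero, zero_add]
  set c₀ := γ - ∫ x in Metric.closedBall (0 : Rd d) 1, x ∂ν
  constructor
  · intro h1
    have h2 := eq_of_exp_eq (f := fun z : Rd d => Complex.I * (inner ℝ c z : ℝ))
      (g := fun z : Rd d => Complex.I * (inner ℝ c₀ z : ℝ)) (by fun_prop) (by fun_prop) (by simp)
      (by simp) fun z => by
        have := h1 z
        rw [Complex.exp_add, Complex.exp_add] at this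
        exact (mul_left_cancel₀ (Complex.exp_ne_zero _) this).symm
    refine ext_inner_right ℝ fun z => ?_
    exact_mod_cast mul_left_cancel₀ Complex.I_ne_zero (congrFun h2 z)
  · rintro rfl z
    rfl

lemma setIntegral_closedBall_invMeasure {ν : Measure (Rd d)} (hν : IsLevyMeasure ν) :
    ∫ x in Metric.closedBall (0 : Rd d) 1, x ∂(invMeasure ν) =
      ∫ x in {x : Rd d | 1 ≤ ‖x‖}, x ∂ν := by
  rw [← integral_indicator measurableSet_closedBall, ← integral_indicator measurableSet_one_le_norm,
    integral_invMeasure]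
  refine integral_congr_ae ?_
  filter_upwards [hν.ae_ne_zero] with x hx
  have hx0 : 0 < ‖x‖ := norm_pos_iff.2 hx
  by_cases h : 1 ≤ ‖x‖
  · have hm : geomInv x ∈ Metric.closedBall (0 : Rd d) 1 := by
      rw [mem_closedBall_zero_iff, norm_geomInv]
      exact inv_le_one_of_one_le₀ h
    rw [Set.indicator_of_mem hm, Set.indicator_of_mem (by simpa using h), geomInv, smul_smul,
      mul_inv_cancel₀ (by positivity), one_smul]
  · rw [Set.indicator_of_notMem, Set.indicator_of_notMem (by simpa using h), smul_zero]
    rw [mem_closedBall_zero_iff, norm_geomInv, not_le]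
    exact (one_lt_inv₀ hx0).2 (not_le.1 h)

lemma HasTriplet.isDrift_inversion_iff {μ : ProbabilityMeasure (Rd d)} {ν : Measure (Rd d)}
    {γ : Rd d} (hμ : HasTriplet μ 0 ν γ) (hm : HasMean μ) (c : Rd d) :
    IsDrift (LevyInversion.inversion μ) c ↔ c = -mean μ := by
  have hν := hμ.isLevyMeasure
  rw [hμ.inversion.isDrift_iff (hμ.hasDrift_inversion_iff.2 hm), hμ.mean_eq hm,
    setIntegral_closedBall_invMeasure hν, invLocation]
  -- Splitting off the unit sphere cancels the sphere term of `invLocation`, leaving minus the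
  -- formula for the mean.
  have hs : {x : Rd d | 1 ≤ ‖x‖} = {x : Rd d | 1 < ‖x‖} ∪ Metric.sphere 0 1 := by
    ext x
    simp [le_iff_lt_or_eq, eq_comm]
  have hd : Disjoint {x : Rd d | 1 < ‖x‖} (Metric.sphere 0 1) := by
    rw [Set.disjoint_left]
    intro x (hx : 1 < ‖x‖) hx'
    rw [mem_sphere_zero_iff_norm] at hx'
    linarith
  rw [hs, setIntegral_union hd Metric.isClosed_sphere.measurableSet
    ((integrableOn_tail (hμ.hasMean_iff.1 hm)).mono_set fun x (hx : 1 < ‖x‖) => hx.le)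
    hν.integrableOn_sphere]
  rw [show -γ + ∫ x in Metric.sphere (0 : Rd d) 1, x ∂ν - (∫ x in {x : Rd d | 1 < ‖x‖}, x ∂ν +
    ∫ x in Metric.sphere (0 : Rd d) 1, x ∂ν) = -(γ + ∫ x in {x : Rd d | 1 < ‖x‖}, x ∂ν) by abel]

end LevyInversion

end

theorem proposition2p1 (d : ℕ) :
    -- (i) every member of `ID_0` has exactly one inversion, which lies in `ID_0`
    (∀ μ ∈ LevyInversion.ID0 d, ∃! μ', LevyInversion.IsInversion μ μ') ∧
    -- (ii) the inversion is an involution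
    (∀ μ ∈ LevyInversion.ID0 d,
      LevyInversion.inversion (LevyInversion.inversion μ) = μ) ∧
    -- (iii) moment identity (both sides may be infinite)
    (∀ μ ∈ LevyInversion.ID0 d, ∀ α : ℝ,
      ∫⁻ x in {x : LevyInversion.Rd d | ‖x‖ ≤ 1}, ENNReal.ofReal (‖x‖ ^ (2 - α))
          ∂(LevyInversion.levyMeasure (LevyInversion.inversion μ)) =
        ∫⁻ x in {x : LevyInversion.Rd d | 1 ≤ ‖x‖}, ENNReal.ofReal (‖x‖ ^ α)
          ∂(LevyInversion.levyMeasure μ)) ∧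
    -- (iv) drift of the inversion and mean
    (∀ μ ∈ LevyInversion.ID0 d,
      LevyInversion.HasDrift (LevyInversion.inversion μ) ↔ LevyInversion.HasMean μ) ∧
    -- (v) the drift of the inversion is minus the mean
    (∀ μ ∈ LevyInversion.ID0 d, LevyInversion.HasMean μ → ∀ c : LevyInversion.Rd d,
      LevyInversion.IsDrift (LevyInversion.inversion μ) c ↔ c = -LevyInversion.mean μ) ∧
    -- (vi) continuity for weak convergence
    (∀ (μ : ProbabilityMeasure (LevyInversion.Rd d))
      (μs : ℕ → ProbabilityMeasure (LevyInversion.Rd d)),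
      μ ∈ LevyInversion.ID0 d → (∀ n, μs n ∈ LevyInversion.ID0 d) →
      Tendsto μs atTop (𝓝 μ) →
      Tendsto (fun n => LevyInversion.inversion (μs n)) atTop
        (𝓝 (LevyInversion.inversion μ))) ∧
    -- (vii) convolution
    (∀ μ₁ ∈ LevyInversion.ID0 d, ∀ μ₂ ∈ LevyInversion.ID0 d,
      LevyInversion.conv μ₁ μ₂ ∈ LevyInversion.ID0 d ∧
      LevyInversion.inversion (LevyInversion.conv μ₁ μ₂) =
        LevyInversion.conv (LevyInversion.inversion μ₁) (LevyInversion.inversion μ₂)) ∧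
    -- (viii) convolution powers
    (∀ μ ∈ LevyInversion.ID0 d, ∀ s : ℝ, 0 ≤ s →
      (∃! ρ, LevyInversion.IsConvPower μ s ρ) ∧
      LevyInversion.convPower μ s ∈ LevyInversion.ID0 d ∧
      LevyInversion.inversion (LevyInversion.convPower μ s) =
        LevyInversion.convPower (LevyInversion.inversion μ) s) ∧
    -- (ix) delta distributions
    (∀ c : LevyInversion.Rd d,
      diracProba c ∈ LevyInversion.ID0 d ∧
      LevyInversion.inversion (diracProba c) = diracProba (-c)) := by
  refine ⟨fun μ hμ => ?_, fun μ hμ => ?_, fun μ hμ α => ?_, fun μ hμ => ?_, fun μ hμ hm c => ?_,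
    fun μ μs hμ hs h => ?_, fun μ₁ h₁ μ₂ h₂ => ?_, fun μ hμ s hs => ?_, fun c => ?_⟩
  · exact (LevyInversion.hasTriplet_of_mem_ID0 hμ).existsUnique_isInversion
  · exact (LevyInversion.hasTriplet_of_mem_ID0 hμ).inversion_inversion
  · exact (LevyInversion.hasTriplet_of_mem_ID0 hμ).lintegral_rpow_inversion α
  · exact (LevyInversion.hasTriplet_of_mem_ID0 hμ).hasDrift_inversion_iff
  · exact (LevyInversion.hasTriplet_of_mem_ID0 hμ).isDrift_inversion_iff hm c
  · exact LevyInversion.tendsto_inversion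
      (fun n => LevyInversion.hasTriplet_of_mem_ID0 (hs n))
      (LevyInversion.hasTriplet_of_mem_ID0 hμ) h
  · have ht₁ := LevyInversion.hasTriplet_of_mem_ID0 h₁
    have ht₂ := LevyInversion.hasTriplet_of_mem_ID0 h₂
    exact ⟨(ht₁.conv ht₂).mem_ID0, ht₁.inversion_conv ht₂⟩
  · have ht := LevyInversion.hasTriplet_of_mem_ID0 hμ
    exact ⟨ht.existsUnique_isConvPower hs, (ht.convPower hs).mem_ID0, ht.inversion_convPower hs⟩
  · exact ⟨(LevyInversion.hasTriplet_diracProba c).mem_ID0, LevyInversion.inversion_diracProba c⟩
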